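/- For $z\in\mathbb C\setminus[0,8]$ and $n=(n_1,n_2)\in\mathbb Z^2$ let $$G(z,n_1,n_2)=(2\pi)^{-2}\int_{(-\pi,\pi]^2}\frac{e^{i(n_1\theta_1+n_2\theta_2)}}{4-2\cos\theta_1-2\cos\theta_2-z}\,d\theta ,$$ the kernel of the resolvent $(H_0-z)^{-1}$ of the discrete Laplacian $(H_0u)[n]=\sum_{j=1}^{2}(2u[n]-u[n+e_j]-u[n-e_j])$ on $\ell^2(\mathbb Z^2)$. For $m,l\in\mathbb Z$ put $$P(m,l)=(-1)^{m+l}G(z,m+l,m-l),\qquad Q(m,l)=(-1)^{m+l}G(z,m+l+1,m-l),\qquad P_0(m)=P(m,0)=(-1)^mG(z,m,m).$$ Let $(q)_0=1$ and $(q)_k=q(q+1)\cdots(q+k-1)$ for $k\ge 1$, let $\psi=\Gamma'/\Gamma$ be the digamma function, let $\log$ be the principal logarithm, and let $${}_4F_3\left(\begin{matrix}a_1,a_2,a_3,a_4\\ b_1,b_2,b_3\end{matrix};w\right)=\sum_{k=0}^\infty\frac{(a_1)_k(a_2)_k(a_3)_k(a_4)_k}{(b_1)_k(b_2)_k(b_3)_k}\frac{w^k}{k!}.$$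 **Theorem 19080717** (endpoint thresholds in dimension two). (1) Let $z\in\mathbb C\setminus[0,8]$ with $|z(8-z)|<16$ and $\pm\operatorname{Re}(4-z)>0$, and let $m\in\mathbb Z$. Then, with the corresponding sign (and with convergence of the series), $$P_0(m)=\pm\frac{(-1)^m}{4\pi}\sum_{k=0}^\infty\frac{(\frac12+m)_k(\frac12-m)_k}{k!\,k!}\left(\frac{z(8-z)}{16}\right)^k\left[2\psi(1+k)-\psi(\tfrac12+m+k)-\psi(\tfrac12-m+k)-\log\frac{z(z-8)}{16}\right].$$ (2) Let $z\in\mathbb C\setminus[0,8]$ and let $m,l\ge 0$ be integers. With $w=\frac{(z-4)^2}{16}$, $$\begin{aligned}P(m,l)={}&\frac{z-4}4\,ml\;{}_4F_3\left(\begin{matrix}1+m,1-m,1+l,1-l\\ 1,\frac32,\frac32\end{matrix};w\right)+P_0(0)\;{}_4F_3\left(\begin{matrix}m,-m,l,-l\\ 1,\frac12,\frac12\end{matrix};w\right)\\ &+\sum_{\mu=1}^{m}\bigl[P_0(\mu)-P_0(\mu-1)\bigr]\,{}_4F_3\left(\begin{matrix}1+m-\mu,\mu-m,l,-l\\ 1,\frac12,\frac12\end{matrix};w\right)\\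 &+\sum_{\nu=1}^{l}\bigl[P_0(\nu)-P_0(\nu-1)\bigr]\,{}_4F_3\left(\begin{matrix}m,-m,1+l-\nu,\nu-l\\ 1,\frac12,\frac12\end{matrix};w\right)\end{aligned}$$ and $$\begin{aligned}Q(m,l)={}&-\frac14\;{}_4F_3\left(\begin{matrix}1+m,-m,1+l,-l\\ 1,\frac12,\frac12\end{matrix};w\right)+\frac{z-4}4(2m+1)(2l+1)P_0(0)\;{}_4F_3\left(\begin{matrix}1+m,-m,1+l,-l\\ 1,\frac32,\frac32\end{matrix};w\right)\\ &-\frac{z-4}4(2l+1)\sum_{\mu=-m}^{m}P_0(\mu)\;{}_4F_3\left(\begin{matrix}1+m-|\mu|,|\mu|-m,1+l,-l\\ 1,\frac12,\frac32\end{matrix};w\right)\\ &-\frac{z-4}4(2m+1)\sum_{\nu=-l}^{l}P_0(\nu)\;{}_4F_3\left(\begin{matrix}1+m,-m,1+l-|\nu|,|\nu|-l\\ 1,\frac12,\frac32\end{matrix};w\right).\end{aligned}$$ Here every ${}_4F_3$ has a non-positive integer among its upper parameters, so it is a polynomial in $w$; the only exception is the first term of $P(m,l)$ for $m=l=0$,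 and that term is understood to be $0$ because of its factor $ml$. -/

import Mathlib

noncomputable section

namespace SquareLattice

/-- The kernel `G(z, n)` of the resolvent `(H₀ - z)⁻¹` of the discrete Laplacian on `ℤ^d`, as an
integral over the torus, which is represented by the fundamental domain `(-π, π]^d`. It is
meaningful for `z ∉ [0, 4d]`; then the integrand is continuous and bounded. -/
def G {d : ℕ} (z : ℂ) (n : Fin d → ℤ) : ℂ :=
  ((2 * Real.pi : ℝ) : ℂ)⁻¹ ^ d *
    ∫ θ in Set.univ.pi (fun _ : Fin d => Set.Ioc (-Real.pi) Real.pi),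
      Complex.exp (Complex.I * ∑ j, (n j : ℂ) * (θ j : ℂ)) /
        (2 * (d : ℂ) - (∑ j, 2 * Complex.cos (θ j : ℂ)) - z)

/-- `P(m, l) = (-1)^(m+l) G(z, m+l, m-l)` in dimension two. -/
def P (z : ℂ) (m l : ℤ) : ℂ := (-1) ^ (m + l) * G z ![m + l, m - l]

/-- `Q(m, l) = (-1)^(m+l) G(z, m+l+1, m-l)` in dimension two. -/
def Q (z : ℂ) (m l : ℤ) : ℂ := (-1) ^ (m + l) * G z ![m + l + 1, m - l]

/-- The diagonal values `P₀(m) = P(m, 0) = (-1)^m G(z, m, m)`. -/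
def P₀ (z : ℂ) (m : ℤ) : ℂ := P z m 0

/-- The Pochhammer symbol `(q)_k = q (q+1) ⋯ (q+k-1)`. -/
def poch (q : ℂ) (k : ℕ) : ℂ := (ascPochhammer ℂ k).eval q

/-- The `k`-th term of the generalized hypergeometric series with upper parameters `a` and
lower parameters `b`. -/
def pFqTerm (a b : List ℂ) (w : ℂ) (k : ℕ) : ℂ :=
  (a.map (poch · k)).prod / (b.map (poch · k)).prod * (w ^ k / (k.factorial : ℂ))

/-- The generalized hypergeometric series `_pF_q(a; b; w)`. -/
def pFq (a b : List ℂ) (w : ℂ) : ℂ := ∑' k, pFqTerm a b w k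

/-- A generalized hypergeometric series with an upper parameter `-N` terminates: it is a
polynomial of degree at most `N` in `w`. -/
theorem hasSum_pFqTerm {a : List ℂ} (b : List ℂ) (w : ℂ) {N : ℕ} (h : -(N : ℂ) ∈ a) :
    HasSum (pFqTerm a b w) (∑ k ∈ Finset.range (N + 1), pFqTerm a b w k) := by
  apply hasSum_sum_of_ne_finset_zero
  intro k hk
  have hk' : N < k := by simpa using hk
  have h0 : (a.map (poch · k)).prod = 0 := by
    apply List.prod_eq_zero
    rw [List.mem_map]
    exact ⟨_, h, ascPochhammer_eval_neg_coe_nat_of_lt hk'⟩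
  simp [pFqTerm, h0]

/-- The value of a terminating hypergeometric series is the corresponding finite sum. -/
theorem pFq_eq_sum {a : List ℂ} (b : List ℂ) (w : ℂ) {N : ℕ} (h : -(N : ℂ) ∈ a) :
    pFq a b w = ∑ k ∈ Finset.range (N + 1), pFqTerm a b w k :=
  (hasSum_pFqTerm b w h).tsum_eq

/-- The `k`-th term of the expansion of the diagonal values around `z = 0, 8`, without the
overall factor `±(-1)^m / (4π)`. -/
def diagTerm (z : ℂ) (m : ℤ) (k : ℕ) : ℂ :=
  poch (1 / 2 + m) k * poch (1 / 2 - m) k / ((k.factorial : ℂ) * (k.factorial : ℂ)) *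
    (z * (8 - z) / 16) ^ k *
    (2 * Complex.digamma (1 + k) - Complex.digamma (1 / 2 + m + k) -
      Complex.digamma (1 / 2 - m + k) - Complex.log (z * (z - 8) / 16))

end SquareLattice

end

/-! In the rotated coordinates n = (m+l, m-l) and n = (m+l+1, m-l), and with the sign (-1)^(m+l),
the lattice equation becomes a pair of mixed difference equations: the forward difference in m and l
of P is (4-z)Q, and the backward one of Q is (4-z)P minus a source at the origin (`P_diff`,
`Q_diff`). With reflection symmetry they determine P and Q on the quadrant from the diagonal values.
The closed forms are sums over k of w^k times products of functions of m and of l. The coefficient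
families `cA`, `cB`, `cC`, `cD` are permuted by differencing, two of the four differences lowering k
by one, so the closed forms obey the same equations (`sP_diff`, `sQ_diff`) with the same boundary
data, and induction over the quadrant (`P_Q_eq_sum`) identifies them.

For the diagonal values, the variable φ = θ₁+θ₂ and a Poisson kernel with complex parameter reduce
G(z,m,m) to a constant times J(y) = ∫ e^{imφ} (y + sin²(φ/2))^{-1/2} dφ with y = z(z-8)/16
(`G_diag`). J satisfies the hypergeometric equation y(1+y)J'' + (1+2y)J' + (1/4-m²)J = 0
(`diagInt_ode`). Near 0 this has a power series solution F and a logarithmic solution L = A - F log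
y, where A has digamma coefficients (`regSol_ode`, `logPart_ode`). Constancy of Wronskians on the
slit disc makes J a combination of L and F. The asymptotics J + 2 log y → 2(2ψ(1) - ψ(1/2+m) -
ψ(1/2-m)) as y ↓ 0 (`tendsto_diagInt_add_log`) force J = 2L (`diagInt_eq`). -/

noncomputable section

/-! ### Torus integrals, symmetries of the kernel and the lattice equation -/

namespace SquareLattice

open MeasureTheory Complex intervalIntegral

/-- The denominator of the resolvent kernel in dimension two does not vanish off `[0, 8]`. -/
theorem symbol_sub_ne_zero {z : ℂ} (hz : z ∉ ((↑) : ℝ → ℂ) '' Set.Icc (0 : ℝ) 8) (x y : ℝ) :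
    4 - z - 2 * cos (x : ℂ) - 2 * cos (y : ℂ) ≠ 0 := by
  intro h
  apply hz
  refine ⟨4 - 2 * Real.cos x - 2 * Real.cos y, ⟨?_, ?_⟩, ?_⟩
  · linarith [Real.cos_le_one x, Real.cos_le_one y]
  · linarith [Real.neg_one_le_cos x, Real.neg_one_le_cos y]
  · push_cast
    linear_combination h

/-- The integrand of `G` in dimension two. -/
def kern (z : ℂ) (a b : ℤ) (x y : ℝ) : ℂ :=
  exp (I * (a * x + b * y)) / (4 - z - 2 * cos (x : ℂ) - 2 * cos (y : ℂ))

theorem continuous_kern {z : ℂ} (hz : z ∉ ((↑) : ℝ → ℂ) '' Set.Icc (0 : ℝ) 8) (a b : ℤ) :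
    Continuous (Function.uncurry (kern z a b)) := by
  unfold kern Function.uncurry
  refine Continuous.div (by fun_prop) (by fun_prop) fun p => symbol_sub_ne_zero hz p.1 p.2

/-- The double integral over the torus. -/
def torusInt (f : ℝ → ℝ → ℂ) : ℂ :=
  ∫ x in -Real.pi..Real.pi, ∫ y in -Real.pi..Real.pi, f x y

theorem G_eq_torusInt {z : ℂ} (hz : z ∉ ((↑) : ℝ → ℂ) '' Set.Icc (0 : ℝ) 8) (a b : ℤ) :
    G z ![a, b] = ((2 * Real.pi : ℝ) : ℂ)⁻¹ ^ 2 * torusInt (kern z a b) := by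
  have hpi : -Real.pi ≤ Real.pi := by linarith [Real.pi_pos]
  unfold G
  congr 1
  have h1 := (volume_preserving_finTwoArrow ℝ).setIntegral_preimage_emb
    (MeasurableEquiv.finTwoArrow.measurableEmbedding) (Function.uncurry (kern z a b))
    (Set.Ioc (-Real.pi) Real.pi ×ˢ Set.Ioc (-Real.pi) Real.pi)
  have h2 : (MeasurableEquiv.finTwoArrow : (Fin 2 → ℝ) ≃ᵐ ℝ × ℝ) ⁻¹'
      (Set.Ioc (-Real.pi) Real.pi ×ˢ Set.Ioc (-Real.pi) Real.pi) =
      Set.univ.pi (fun _ : Fin 2 => Set.Ioc (-Real.pi) Real.pi) := by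
    ext θ
    simp [MeasurableEquiv.finTwoArrow, Set.mem_pi, Fin.forall_fin_two]
  rw [h2] at h1
  have hint : IntegrableOn (Function.uncurry (kern z a b))
      (Set.Ioc (-Real.pi) Real.pi ×ˢ Set.Ioc (-Real.pi) Real.pi) (volume.prod volume) :=
    ((continuous_kern hz a b).continuousOn.integrableOn_compact
      (isCompact_Icc.prod isCompact_Icc)).mono_set
      (Set.prod_mono Set.Ioc_subset_Icc_self Set.Ioc_subset_Icc_self)
  rw [Measure.volume_eq_prod, setIntegral_prod _ hint] at h1
  unfold torusInt
  simp only [intervalIntegral.integral_of_le hpi]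
  refine Eq.trans ?_ h1
  refine integral_congr_ae (Filter.Eventually.of_forall fun θ => ?_)
  simp only [Function.uncurry, kern, MeasurableEquiv.finTwoArrow, Fin.sum_univ_two]
  simp
  congr 1
  ring

theorem continuous_inner {f : ℝ → ℝ → ℂ} (hf : Continuous (Function.uncurry f)) (a b : ℝ) :
    Continuous fun x => ∫ y in a..b, f x y :=
  continuous_parametric_intervalIntegral_of_continuous' hf a b

theorem torusInt_add {f g : ℝ → ℝ → ℂ} (hf : Continuous (Function.uncurry f))
    (hg : Continuous (Function.uncurry g)) :
    torusInt (fun x y => f x y + g x y) = torusInt f + torusInt g := by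
  unfold torusInt
  rw [← integral_add ((continuous_inner hf _ _).intervalIntegrable _ _)
    ((continuous_inner hg _ _).intervalIntegrable _ _)]
  refine integral_congr fun x _ => ?_
  exact integral_add ((hf.uncurry_left x).intervalIntegrable _ _)
    ((hg.uncurry_left x).intervalIntegrable _ _)

theorem torusInt_const_mul (c : ℂ) (f : ℝ → ℝ → ℂ) :
    torusInt (fun x y => c * f x y) = c * torusInt f := by
  simp [torusInt]

theorem torusInt_swap {f : ℝ → ℝ → ℂ} (hf : Continuous (Function.uncurry f)) :
    torusInt (fun x y => f y x) = torusInt f := by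
  unfold torusInt
  symm
  apply intervalIntegral_intervalIntegral_swap
  exact (hf.continuousOn.integrableOn_compact (isCompact_uIcc.prod isCompact_uIcc)).mono_set
      (Set.prod_mono Set.uIoc_subset_uIcc Set.uIoc_subset_uIcc)

theorem torusInt_neg_left (f : ℝ → ℝ → ℂ) :
    torusInt (fun x y => f (-x) y) = torusInt f := by
  unfold torusInt
  rw [integral_comp_neg (fun x => ∫ y in -Real.pi..Real.pi, f x y)]
  simp

theorem G_swap {z : ℂ} (hz : z ∉ ((↑) : ℝ → ℂ) '' Set.Icc (0 : ℝ) 8) (a b : ℤ) :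
    G z ![a, b] = G z ![b, a] := by
  rw [G_eq_torusInt hz, G_eq_torusInt hz, ← torusInt_swap (continuous_kern hz a b)]
  congr 2
  ext x y
  simp only [kern]
  congr 1
  · ring_nf
  · ring

theorem G_neg_left {z : ℂ} (hz : z ∉ ((↑) : ℝ → ℂ) '' Set.Icc (0 : ℝ) 8) (a b : ℤ) :
    G z ![-a, b] = G z ![a, b] := by
  rw [G_eq_torusInt hz, G_eq_torusInt hz, ← torusInt_neg_left]
  congr 2
  ext x y
  simp [kern]

theorem G_neg_right {z : ℂ} (hz : z ∉ ((↑) : ℝ → ℂ) '' Set.Icc (0 : ℝ) 8) (a b : ℤ) :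
    G z ![a, -b] = G z ![a, b] := by
  rw [G_swap hz, G_neg_left hz, G_swap hz]

theorem integral_exp_int (a : ℤ) :
    ∫ x in -Real.pi..Real.pi, exp (I * (a * x)) = if a = 0 then 2 * (Real.pi : ℂ) else 0 := by
  split_ifs with h
  · simp [h]; ring
  · have h' : I * (a : ℂ) ≠ 0 := by simp [h]
    simp only [← mul_assoc]
    rw [integral_exp_mul_complex h']
    have : I * (a : ℂ) * (Real.pi : ℝ) = I * a * ((-Real.pi : ℝ) : ℂ) + a * (2 * Real.pi * I) := by
      push_cast; ring
    rw [this, exp_periodic.int_mul a]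
    simp

theorem torusInt_exp (a b : ℤ) :
    torusInt (fun x y => exp (I * (a * x + b * y))) =
      if a = 0 ∧ b = 0 then (2 * (Real.pi : ℂ)) ^ 2 else 0 := by
  unfold torusInt
  simp only [mul_add, exp_add, intervalIntegral.integral_const_mul,
    intervalIntegral.integral_mul_const, integral_exp_int]
  by_cases ha : a = 0 <;> by_cases hb : b = 0 <;> simp [ha, hb]; ring

/-- The lattice equation `(H₀ - z) G = δ`. -/
theorem lattice_equation {z : ℂ} (hz : z ∉ ((↑) : ℝ → ℂ) '' Set.Icc (0 : ℝ) 8) (a b : ℤ) :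
    (4 - z) * G z ![a, b] - G z ![a + 1, b] - G z ![a - 1, b] - G z ![a, b + 1] - G z ![a, b - 1] =
      if a = 0 ∧ b = 0 then 1 else 0 := by
  -- Shifting an index multiplies the integrand by e^{±ix} or e^{±iy}. The five terms rebuild the
  -- denominator and leave the bare character.
  have key : (fun x y : ℝ => exp (I * (a * x + b * y))) = fun x y => ((4 - z) * kern z a b x y +
      ((-1) * kern z (a + 1) b x y + ((-1) * kern z (a - 1) b x y + ((-1) * kern z a (b + 1) x y +
        (-1) * kern z a (b - 1) x y)))) := by
    ext x y
    have h := symbol_sub_ne_zero hz x y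
    simp only [kern]
    have e1 : exp (I * ((a + 1 : ℤ) * x + b * y)) = exp (I * (a * x + b * y)) * exp (x * I) := by
      rw [← exp_add]; push_cast; ring_nf
    have e2 : exp (I * ((a - 1 : ℤ) * x + b * y)) = exp (I * (a * x + b * y)) * exp (-x * I) := by
      rw [← exp_add]; push_cast; ring_nf
    have e3 : exp (I * (a * x + (b + 1 : ℤ) * y)) = exp (I * (a * x + b * y)) * exp (y * I) := by
      rw [← exp_add]; push_cast; ring_nf
    have e4 : exp (I * (a * x + (b - 1 : ℤ) * y)) = exp (I * (a * x + b * y)) * exp (-y * I) := by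
      rw [← exp_add]; push_cast; ring_nf
    rw [e1, e2, e3, e4]
    have c1 := two_cos (x : ℂ)
    have c2 := two_cos (y : ℂ)
    generalize exp (x * I) = p1 at *
    generalize exp (-x * I) = p2 at *
    generalize exp (y * I) = p3 at *
    generalize exp (-y * I) = p4 at *
    field_simp
    linear_combination -(c1 + c2)
  have h := torusInt_exp a b
  have cc : ∀ (c : ℂ) (a b : ℤ), Continuous (Function.uncurry fun x y => c * kern z a b x y) :=
    fun c a b => (continuous_kern hz a b).const_mul c
  rw [key] at h
  rw [torusInt_add, torusInt_add, torusInt_add, torusInt_add] at h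
  · simp only [torusInt_const_mul] at h
    simp only [G_eq_torusInt hz]
    have hpi : (Real.pi : ℂ) ≠ 0 := by exact_mod_cast Real.pi_ne_zero
    have : (if a = 0 ∧ b = 0 then (1 : ℂ) else 0) = (2 * (Real.pi : ℂ))⁻¹ ^ 2 *
        (if a = 0 ∧ b = 0 then (2 * (Real.pi : ℂ)) ^ 2 else 0) := by
      split_ifs
      · field_simp
      · simp
    rw [this, ← h]
    push_cast
    ring
  · exact cc _ _ _
  · exact cc _ _ _
  · exact cc _ _ _
  · exact (cc _ _ _).add (cc _ _ _)
  · exact cc _ _ _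
  · exact (cc _ _ _).add ((cc _ _ _).add (cc _ _ _))
  · exact cc _ _ _
  · exact (cc _ _ _).add ((cc _ _ _).add ((cc _ _ _).add (cc _ _ _)))

end SquareLattice

end

/-! ### Discrete calculus of the hypergeometric coefficients and the closed forms -/

noncomputable section

namespace SquareLattice

theorem poch_zero (q : ℂ) : poch q 0 = 1 := by simp [poch]

theorem poch_succ_right (q : ℂ) (k : ℕ) : poch q (k + 1) = poch q k * (q + k) := by
  simp [poch, ascPochhammer_succ_right]

theorem poch_succ_left (q : ℂ) (k : ℕ) : poch q (k + 1) = q * poch (q + 1) k := by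
  simp [poch, ascPochhammer_succ_left, Polynomial.eval_comp]

theorem poch_neg_natCast {m k : ℕ} (h : m < k) : poch (-(m : ℂ)) k = 0 :=
  ascPochhammer_eval_neg_coe_nat_of_lt h

theorem poch_ne_zero {q : ℂ} (h : ∀ k : ℕ, q + k ≠ 0) (k : ℕ) : poch q k ≠ 0 := by
  induction k with
  | zero => simp [poch_zero]
  | succ k ih => rw [poch_succ_right]; exact mul_ne_zero ih (h k)

theorem half_add_int_ne_zero (n : ℤ) : (1 / 2 + n : ℂ) ≠ 0 := by
  intro h
  have h' : ((1 + 2 * n : ℤ) : ℂ) = 0 := by push_cast; linear_combination 2 * h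
  have h2 : 1 + 2 * n = 0 := by exact_mod_cast h'
  omega

theorem poch_half_ne_zero (k : ℕ) : poch (1 / 2) k ≠ 0 :=
  poch_ne_zero (fun k => by exact_mod_cast half_add_int_ne_zero k) k

theorem poch_three_halves_ne_zero (k : ℕ) : poch (3 / 2) k ≠ 0 :=
  poch_ne_zero (fun k => by
    have := half_add_int_ne_zero (k + 1)
    push_cast at this
    convert this using 1; ring) k

theorem poch_half_succ (k : ℕ) : poch (1 / 2) (k + 1) = 1 / 2 * poch (3 / 2) k := by
  rw [poch_succ_left]; norm_num

theorem poch_one (k : ℕ) : poch 1 k = k.factorial := by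
  simp [poch]

/-- Any bound beyond the degree is allowed, so series terminating at different degrees can share one
summation range and be added term by term. -/
theorem pFq_eq_sum_range {a : List ℂ} (b : List ℂ) (w : ℂ) {n N : ℕ} (h : -(n : ℂ) ∈ a)
    (hN : n < N) : pFq a b w = ∑ k ∈ Finset.range N, pFqTerm a b w k := by
  rw [pFq_eq_sum b w h]
  apply Finset.sum_subset
  · intro k; simp; omega
  · intro k _ hk
    have hk' : n < k := by simpa using hk
    have h0 : (a.map (poch · k)).prod = 0 := by
      apply List.prod_eq_zero
      rw [List.mem_map]
      exact ⟨_, h, poch_neg_natCast hk'⟩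
    simp [pFqTerm, h0]

/-- The coefficients `(x)_k (-x)_k / (k! (1/2)_k)`. -/
def cA (k : ℕ) (x : ℂ) : ℂ := poch x k * poch (-x) k / (k.factorial * poch (1 / 2) k)

/-- The coefficients `(1+x)_k (-x)_k / (k! (1/2)_k)`. -/
def cB (k : ℕ) (x : ℂ) : ℂ := poch (1 + x) k * poch (-x) k / (k.factorial * poch (1 / 2) k)

/-- The coefficients `x (1+x)_k (1-x)_k / (k! (3/2)_k)`. -/
def cC (k : ℕ) (x : ℂ) : ℂ :=
  x * (poch (1 + x) k * poch (1 - x) k) / (k.factorial * poch (3 / 2) k)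

/-- The coefficients `(2x+1) (1+x)_k (-x)_k / (k! (3/2)_k)`. -/
def cD (k : ℕ) (x : ℂ) : ℂ :=
  (2 * x + 1) * (poch (1 + x) k * poch (-x) k) / (k.factorial * poch (3 / 2) k)

theorem cA_zero (x : ℂ) : cA 0 x = 1 := by simp [cA, poch_zero]
theorem cB_zero (x : ℂ) : cB 0 x = 1 := by simp [cB, poch_zero]
theorem cD_zero (x : ℂ) : cD 0 x = 2 * x + 1 := by simp [cD, poch_zero]

theorem cC_at_zero (k : ℕ) : cC k 0 = 0 := by simp [cC]

theorem cA_natCast {m k : ℕ} (h : m < k) : cA k m = 0 := by simp [cA, poch_neg_natCast h]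
theorem cB_natCast {m k : ℕ} (h : m < k) : cB k m = 0 := by simp [cB, poch_neg_natCast h]
theorem cD_natCast {m k : ℕ} (h : m < k) : cD k m = 0 := by simp [cD, poch_neg_natCast h]
theorem cC_natCast {m k : ℕ} (h : m < k + 1) : cC k m = 0 := by
  rcases m with _ | m
  · simp [cC]
  · have : poch (1 - ((m + 1 : ℕ) : ℂ)) k = 0 := by
      have := poch_neg_natCast (m := m) (k := k) (by omega)
      convert this using 2; push_cast; ring
    rw [cC, this]; simp

theorem factorial_ne (k : ℕ) : (k.factorial : ℂ) ≠ 0 := by exact_mod_cast k.factorial_ne_zero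

theorem three_halves_eq (k : ℕ) : poch (3 / 2) k = poch (1 / 2) k * (2 * k + 1) := by
  have h := poch_half_succ k
  rw [poch_succ_right] at h
  linear_combination (-2) * h

theorem two_mul_add_one_ne (k : ℕ) : (2 * k + 1 : ℂ) ≠ 0 := by
  exact_mod_cast (by omega : 2 * k + 1 ≠ 0)

/-- First of four rules: forward differences send `cA (k+1)` to `cD k` and `cC k` to `cB k`;
backward differences send `cB (k+1)` to `cC k` and `cD k` to `cA k`, up to constants. Here both
terms share the factor (1+x)_k (-x)_k, leaving a polynomial identity. -/
theorem cA_diff (k : ℕ) (x : ℂ) : cA (k + 1) (x + 1) - cA (k + 1) x = -2 * cD k x := by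
  have h3 := poch_three_halves_ne_zero k
  have hf := factorial_ne k
  have hk : (k + 1 : ℂ) ≠ 0 := by exact_mod_cast k.succ_ne_zero
  simp only [cA, cD, poch_half_succ, Nat.factorial_succ]
  rw [poch_succ_right (x + 1), poch_succ_left (-(x + 1)), poch_succ_left x, poch_succ_right (-x),
    show -(x + 1) + 1 = -x by ring, add_comm 1 x]
  push_cast
  field_simp
  ring

/-- The degree does not drop, so no common Pochhammer factor splits off. The two expansions of
(q)_{k+1} give q (q+1)_k = (q)_k (q+k), which replaces it. -/
theorem cC_diff (k : ℕ) (x : ℂ) : cC k (x + 1) - cC k x = cB k x := by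
  have h3 := poch_half_ne_zero k
  have hf := factorial_ne k
  have hk := two_mul_add_one_ne k
  simp only [cC, cB, three_halves_eq]
  have e1 := poch_succ_left (1 + x) k
  have e2 := poch_succ_left (-x) k
  rw [poch_succ_right] at e1 e2
  rw [show 1 + (x + 1) = 1 + x + 1 by ring, show 1 - (x + 1) = -x by ring,
    show 1 - x = -x + 1 by ring]
  generalize poch (1 + x + 1) k = p1 at *
  generalize poch (-x + 1) k = p2 at *
  field_simp
  linear_combination (-poch (-x) k) * e1 - poch (1 + x) k * e2

theorem cB_diff (k : ℕ) (x : ℂ) : cB (k + 1) x - cB (k + 1) (x - 1) = -4 * cC k x := by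
  have h3 := poch_three_halves_ne_zero k
  have hf := factorial_ne k
  have hk : (k + 1 : ℂ) ≠ 0 := by exact_mod_cast k.succ_ne_zero
  simp only [cB, cC, poch_half_succ, Nat.factorial_succ]
  rw [poch_succ_right (1 + x), poch_succ_left (-x), show 1 + (x - 1) = x by ring,
    show -(x - 1) = 1 - x by ring, poch_succ_left x, poch_succ_right (1 - x),
    show -x + 1 = 1 - x by ring, add_comm x 1]
  push_cast
  field_simp
  ring

theorem cD_eq (k : ℕ) (x : ℂ) : cD k x = 2 * cC k x + cB k x := by
  have h3 := poch_half_ne_zero k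
  have hf := factorial_ne k
  have hk := two_mul_add_one_ne k
  simp only [cC, cB, cD, three_halves_eq]
  have e2 := poch_succ_left (-x) k
  rw [poch_succ_right] at e2
  rw [show 1 - x = -x + 1 by ring]
  generalize poch (-x + 1) k = p2 at *
  field_simp
  linear_combination (-2 * poch (1 + x) k) * e2

theorem cB_add {x : ℂ} (hx : x ≠ 0) (k : ℕ) : cB k x + cB k (x - 1) = 2 * cA k x := by
  have h3 := poch_half_ne_zero k
  have hf := factorial_ne k
  simp only [cA, cB]
  have e1 := poch_succ_left x k
  have e2 := poch_succ_left (-x) k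
  rw [poch_succ_right] at e1 e2
  rw [show 1 + (x - 1) = x by ring, show -(x - 1) = -x + 1 by ring, add_comm 1 x]
  generalize poch (x + 1) k = p1 at *
  generalize poch (-x + 1) k = p2 at *
  field_simp
  -- The Pochhammer relations `e1` and `e2` express only x (x+1)_k and -x (1-x)_k, hence the extra
  -- factor x.
  apply mul_left_cancel₀ hx
  linear_combination (-poch (-x) k) * e1 + poch x k * e2

theorem cD_diff {x : ℂ} (hx : x ≠ 0) (k : ℕ) : cD k x - cD k (x - 1) = 2 * cA k x := by
  have := cC_diff k (x - 1)
  rw [sub_add_cancel] at this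
  rw [cD_eq, cD_eq, ← cB_add hx]
  linear_combination 2 * this

/-- The convolution of the increments of a sequence with `cB k`. -/
def cU (p : ℕ → ℂ) (k m : ℕ) : ℂ :=
  ∑ i ∈ Finset.range m, (p (i + 1) - p i) * cB k ((m : ℂ) - 1 - i)

/-- The two-sided convolution of an even sequence with `cB k`. -/
def cV (p : ℕ → ℂ) (k m : ℕ) : ℂ :=
  p 0 * cB k m + 2 * ∑ i ∈ Finset.range m, p (i + 1) * cB k ((m : ℂ) - 1 - i)

theorem cast_sub_one_sub {m i : ℕ} (h : i < m) : (m : ℂ) - 1 - i = ((m - 1 - i : ℕ) : ℂ) := by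
  rw [Nat.cast_sub (by omega), Nat.cast_sub (by omega)]; simp

theorem cV_eq_zero (p : ℕ → ℂ) {m k : ℕ} (h : m < k) : cV p k m = 0 := by
  rw [cV, cB_natCast h, Finset.sum_eq_zero]
  · simp
  · intro i hi
    rw [cast_sub_one_sub (Finset.mem_range.1 hi), cB_natCast (by omega), mul_zero]

theorem cU_at_zero (p : ℕ → ℂ) (k : ℕ) : cU p k 0 = 0 := by simp [cU]

theorem cU_zero (p : ℕ → ℂ) (m : ℕ) : cU p 0 m = p m - p 0 := by
  simp only [cU, cB_zero, mul_one, Finset.sum_range_sub]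

/-- Shifting the index in the p_i half of `cU` gives the old sum of `cV` plus a term p₀ `cB k m`;
`cB_add` merges the boundary terms into `cA`. -/
theorem cV_diff (p : ℕ → ℂ) (k m : ℕ) :
    cV p k (m + 1) - cV p k m = 2 * p 0 * cA k (m + 1) + 2 * cU p k (m + 1) := by
  have h0 := cB_add (x := (m : ℂ) + 1) (by exact_mod_cast m.succ_ne_zero) k
  simp only [cV, cU, sub_mul, Finset.sum_sub_distrib]
  rw [Finset.sum_range_succ' (fun i => p i * _)]
  simp only [Nat.cast_add, Nat.cast_one, Nat.cast_zero, add_sub_cancel_right, sub_zero] at *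
  have e : ∀ i : ℕ, (m : ℂ) - (i + 1) = m - 1 - i := fun i => by ring
  simp only [e]
  linear_combination p 0 * h0

/-- The new end term vanishes because `cB (k+1)` is zero at 0, and `cB_diff` turns the weights into
`cC`. Summation by parts then moves the difference from p onto `cC`, which gives `cB`; the boundary
term is corrected by `cD_eq`. -/
theorem cU_diff (p : ℕ → ℂ) (k m : ℕ) :
    cU p (k + 1) (m + 1) - cU p (k + 1) m = -2 * (cV p k m - p 0 * cD k m) := by
  have h0 : cB (k + 1) 0 = 0 := by exact_mod_cast cB_natCast (m := 0) k.succ_pos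
  have h1 : cU p (k + 1) (m + 1) - cU p (k + 1) m =
      -4 * ∑ i ∈ Finset.range m, (p (i + 1) - p i) * cC k (m - i) := by
    simp only [cU]
    rw [Finset.sum_range_succ]
    simp only [Nat.cast_add, Nat.cast_one, add_sub_cancel_right, sub_self, h0, mul_zero, add_zero]
    rw [← Finset.sum_sub_distrib, Finset.mul_sum]
    refine Finset.sum_congr rfl fun i _ => ?_
    have := cB_diff k ((m : ℂ) - i)
    rw [show (m : ℂ) - i - 1 = m - 1 - i by ring] at this
    linear_combination (p (i + 1) - p i) * this
  have h2 : ∑ i ∈ Finset.range m, p i * cC k (m - i) =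
      p 0 * cC k m + ∑ i ∈ Finset.range m, p (i + 1) * cC k (m - 1 - i) := by
    have e1 := Finset.sum_range_succ (fun i : ℕ => p i * cC k ((m : ℂ) - i)) m
    rw [Finset.sum_range_succ'] at e1
    simp only [sub_self, cC_at_zero, mul_zero, add_zero, Nat.cast_zero, sub_zero] at e1
    rw [← e1, add_comm]
    congr 1
    refine Finset.sum_congr rfl fun i _ => ?_
    push_cast; ring_nf
  have h3 : ∑ i ∈ Finset.range m, p (i + 1) * cB k ((m : ℂ) - 1 - i) =
      ∑ i ∈ Finset.range m, p (i + 1) * cC k (m - i) -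
      ∑ i ∈ Finset.range m, p (i + 1) * cC k (m - 1 - i) := by
    rw [← Finset.sum_sub_distrib]
    refine Finset.sum_congr rfl fun i _ => ?_
    have := cC_diff k ((m : ℂ) - 1 - i)
    rw [show (m : ℂ) - 1 - i + 1 = m - i by ring] at this
    rw [← this]; ring
  rw [h1]
  simp only [sub_mul, Finset.sum_sub_distrib, cV, h2, h3, cD_eq]
  ring

/-- The coefficient of `w^k` in the closed form of `P`. -/
def tP (z : ℂ) (p : ℕ → ℂ) (k m l : ℕ) : ℂ :=
  (z - 4) / 4 * (cC k m * cC k l) + p 0 * (cA k m * cA k l) + cU p k m * cA k l + cA k m * cU p k l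

/-- The coefficient of `w^k` in the closed form of `Q`. -/
def tQ (z : ℂ) (p : ℕ → ℂ) (k m l : ℕ) : ℂ :=
  -(1 / 4) * (cB k m * cB k l) +
    (z - 4) / 4 * (p 0 * (cD k m * cD k l) - cV p k m * cD k l - cD k m * cV p k l)

/-- The closed form of `P`, truncated at degree `N`. -/
def sP (z : ℂ) (p : ℕ → ℂ) (N m l : ℕ) : ℂ :=
  ∑ k ∈ Finset.range (N + 1), tP z p k m l * ((z - 4) ^ 2 / 16) ^ k

/-- The closed form of `Q`, truncated at degree `N`. -/
def sQ (z : ℂ) (p : ℕ → ℂ) (N m l : ℕ) : ℂ :=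
  ∑ k ∈ Finset.range (N + 1), tQ z p k m l * ((z - 4) ^ 2 / 16) ^ k

theorem sP_comm (z : ℂ) (p : ℕ → ℂ) (N m l : ℕ) : sP z p N m l = sP z p N l m :=
  Finset.sum_congr rfl fun k _ => by simp only [tP]; ring

theorem sQ_comm (z : ℂ) (p : ℕ → ℂ) (N m l : ℕ) : sQ z p N m l = sQ z p N l m :=
  Finset.sum_congr rfl fun k _ => by simp only [tQ]; ring

theorem sP_at_zero (z : ℂ) (p : ℕ → ℂ) (N m : ℕ) : sP z p N m 0 = p m := by
  rw [sP, Finset.sum_range_succ', Finset.sum_eq_zero]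
  · simp [tP, cA_zero, cC_at_zero, cU_zero]
  · intro k _
    have : cA (k + 1) 0 = 0 := by exact_mod_cast cA_natCast (m := 0) k.succ_pos
    simp [tP, this, cC_at_zero, cU_at_zero]

theorem sQ_at_zero (z : ℂ) (p : ℕ → ℂ) (N m : ℕ) :
    sQ z p N m 0 = -(1 / 4) - (z - 4) / 4 * cV p 0 m := by
  rw [sQ, Finset.sum_range_succ', Finset.sum_eq_zero]
  · simp [tQ, cB_zero, cD_zero, cV]; ring
  · intro k _
    have h1 : cB (k + 1) 0 = 0 := by exact_mod_cast cB_natCast (m := 0) k.succ_pos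
    have h2 : cD (k + 1) 0 = 0 := by exact_mod_cast cD_natCast (m := 0) k.succ_pos
    simp [tQ, h1, h2, cV]

/-- The `cC` product becomes the `cB` product at the same degree. The other terms drop one degree
with factor (-2)² = 4, and 4w = (z-4)²/4 supplies the coefficient of Q. Since m < N, the part of Q
they must match has no term of degree N. -/
theorem sP_diff (z : ℂ) (p : ℕ → ℂ) {N m : ℕ} (l : ℕ) (h : m < N) :
    sP z p N (m + 1) (l + 1) - sP z p N (m + 1) l - sP z p N m (l + 1) + sP z p N m l =
      (4 - z) * sQ z p N m l := by
  have hQ : sQ z p N m l =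
      ∑ k ∈ Finset.range (N + 1), -(1 / 4) * (cB k m * cB k l) * ((z - 4) ^ 2 / 16) ^ k +
      ∑ k ∈ Finset.range N, (z - 4) / 4 *
        (p 0 * (cD k m * cD k l) - cV p k m * cD k l - cD k m * cV p k l) *
          ((z - 4) ^ 2 / 16) ^ k := by
    simp only [sQ, tQ, add_mul, Finset.sum_add_distrib]
    congr 1
    rw [Finset.sum_range_succ, cD_natCast h, cV_eq_zero p h]
    simp
  rw [hQ, mul_add, Finset.mul_sum, Finset.mul_sum]
  simp only [sP]
  rw [← Finset.sum_sub_distrib, ← Finset.sum_sub_distrib, ← Finset.sum_add_distrib,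
    Finset.sum_range_succ', Finset.sum_range_succ', add_right_comm, ← Finset.sum_add_distrib]
  congr 1
  · refine Finset.sum_congr rfl fun k _ => ?_
    have a1 := cA_diff k m
    have a2 := cA_diff k l
    have c1 := cC_diff (k + 1) m
    have c2 := cC_diff (k + 1) l
    have u1 := cU_diff p k m
    have u2 := cU_diff p k l
    simp only [tP, pow_succ, Nat.cast_add, Nat.cast_one]
    rw [sub_eq_iff_eq_add] at a1 a2 c1 c2 u1 u2
    rw [a1, a2, c1, c2, u1, u2]
    ring
  · have c1 := cC_diff 0 m
    have c2 := cC_diff 0 l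
    rw [sub_eq_iff_eq_add] at c1 c2
    simp only [tP, Nat.cast_add, Nat.cast_one, c1, c2, cA_zero, cB_zero, pow_zero, cU_zero]
    ring

/-- The roles are reversed: the `cB` product drops one degree with factor (-4)² = 16, while the `cD`
and `cV` terms keep theirs. The term of degree N that the shift cannot reach vanishes because `cC N`
is zero at m+1 ≤ N. -/
theorem sQ_diff (z : ℂ) (p : ℕ → ℂ) {N m : ℕ} (l : ℕ) (h : m < N) :
    sQ z p N (m + 1) (l + 1) - sQ z p N (m + 1) l - sQ z p N m (l + 1) + sQ z p N m l =
      (4 - z) * sP z p N (m + 1) (l + 1) := by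
  have hP : sP z p N (m + 1) (l + 1) =
      ∑ k ∈ Finset.range N, (z - 4) / 4 * (cC k (m + 1) * cC k (l + 1)) *
        ((z - 4) ^ 2 / 16) ^ k +
      ∑ k ∈ Finset.range (N + 1), (p 0 * (cA k (m + 1) * cA k (l + 1)) +
        cU p k (m + 1) * cA k (l + 1) + cA k (m + 1) * cU p k (l + 1)) *
          ((z - 4) ^ 2 / 16) ^ k := by
    have hc : cC N ((m : ℂ) + 1) = 0 := by exact_mod_cast cC_natCast (m := m + 1) (k := N) (by omega)
    have hs := Finset.sum_range_succ (fun k => (z - 4) / 4 * (cC k (m + 1) * cC k (l + 1)) *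
      ((z - 4) ^ 2 / 16) ^ k) N
    simp only [hc, zero_mul, mul_zero, add_zero] at hs
    rw [← hs, ← Finset.sum_add_distrib]
    refine Finset.sum_congr rfl fun k _ => ?_
    simp only [tP, Nat.cast_add, Nat.cast_one]
    ring
  rw [hP, mul_add, Finset.mul_sum, Finset.mul_sum]
  simp only [sQ]
  rw [← Finset.sum_sub_distrib, ← Finset.sum_sub_distrib, ← Finset.sum_add_distrib,
    Finset.sum_range_succ', Finset.sum_range_succ']
  conv_rhs => rw [← add_assoc, ← Finset.sum_add_distrib]
  have hm : (m : ℂ) + 1 ≠ 0 := by exact_mod_cast m.succ_ne_zero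
  have hl : (l : ℂ) + 1 ≠ 0 := by exact_mod_cast l.succ_ne_zero
  congr 1
  · refine Finset.sum_congr rfl fun k _ => ?_
    have d1 := cD_diff hm (k + 1)
    have d2 := cD_diff hl (k + 1)
    have b1 := cB_diff k ((m : ℂ) + 1)
    have b2 := cB_diff k ((l : ℂ) + 1)
    have v1 := cV_diff p (k + 1) m
    have v2 := cV_diff p (k + 1) l
    rw [add_sub_cancel_right] at d1 d2 b1 b2
    simp only [tQ, pow_succ, Nat.cast_add, Nat.cast_one]
    rw [sub_eq_iff_eq_add] at d1 d2 b1 b2 v1 v2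
    rw [d1, d2, b1, b2, v1, v2]
    ring
  · have d1 := cD_diff hm 0
    have d2 := cD_diff hl 0
    have v1 := cV_diff p 0 m
    have v2 := cV_diff p 0 l
    rw [add_sub_cancel_right] at d1 d2
    rw [sub_eq_iff_eq_add] at d1 d2 v1 v2
    simp only [tQ, Nat.cast_add, Nat.cast_one, d1, d2, v1, v2, cB_zero]
    ring

end SquareLattice

end

/-! ### Recovering P and Q from the diagonal values -/

noncomputable section

namespace SquareLattice

theorem neg_one_zpow_add_one (n : ℤ) : (-1 : ℂ) ^ (n + 1) = -(-1) ^ n := by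
  rw [zpow_add_one₀ (by norm_num)]; ring

theorem neg_one_zpow_sub_one (n : ℤ) : (-1 : ℂ) ^ (n - 1) = -(-1) ^ n := by
  rw [zpow_sub_one₀ (by norm_num)]; norm_num

/-- The neighbours of the site (m+l+1, m-l) are the four corners of a unit square in (m, l), and the
alternating sign turns their sum into a mixed difference. The site is not the origin, by parity. -/
theorem P_diff {z : ℂ} (hz : z ∉ ((↑) : ℝ → ℂ) '' Set.Icc (0 : ℝ) 8) (m l : ℤ) :
    P z (m + 1) (l + 1) - P z (m + 1) l - P z m (l + 1) + P z m l = (4 - z) * Q z m l := by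
  have h := lattice_equation hz (m + l + 1) (m - l)
  rw [if_neg (by omega)] at h
  simp only [P, Q]
  rw [show m + 1 + (l + 1) = m + l + 1 + 1 by ring, show m + 1 + l = m + l + 1 by ring,
    show m + (l + 1) = m + l + 1 by ring, show m + 1 - (l + 1) = m - l by ring,
    show m + 1 - l = m - l + 1 by ring, show m - (l + 1) = m - l - 1 by ring]
  simp only [neg_one_zpow_add_one]
  rw [show m + l + 1 - 1 = m + l by ring] at h
  linear_combination (-(-1) ^ (m + l)) * h

theorem Q_diff {z : ℂ} (hz : z ∉ ((↑) : ℝ → ℂ) '' Set.Icc (0 : ℝ) 8) (m l : ℤ) :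
    Q z m l - Q z m (l - 1) - Q z (m - 1) l + Q z (m - 1) (l - 1) =
      (4 - z) * P z m l - if m = 0 ∧ l = 0 then 1 else 0 := by
  have h := lattice_equation hz (m + l) (m - l)
  have hiff : (m + l = 0 ∧ m - l = 0) ↔ (m = 0 ∧ l = 0) := by omega
  simp only [hiff] at h
  simp only [P, Q]
  rw [show m - 1 + (l - 1) = m + l - 1 - 1 by ring, show m - 1 + l = m + l - 1 by ring,
    show m + (l - 1) = m + l - 1 by ring, show m - 1 - (l - 1) = m - l by ring,
    show m - 1 - l = m - l - 1 by ring, show m - (l - 1) = m - l + 1 by ring]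
  simp only [neg_one_zpow_sub_one]
  rw [show m + l - 1 - 1 + 1 = m + l - 1 by ring, sub_add_cancel]
  have e : (if m = 0 ∧ l = 0 then (1 : ℂ) else 0) =
      (-1) ^ (m + l) * if m = 0 ∧ l = 0 then (1 : ℂ) else 0 := by
    split_ifs with hc
    · simp [hc.1, hc.2]
    · simp
  rw [e]
  linear_combination (-(-1) ^ (m + l)) * h

theorem P_comm {z : ℂ} (hz : z ∉ ((↑) : ℝ → ℂ) '' Set.Icc (0 : ℝ) 8) (m l : ℤ) :
    P z m l = P z l m := by
  simp only [P]
  rw [add_comm, ← G_neg_right hz, neg_sub]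

theorem P₀_neg {z : ℂ} (hz : z ∉ ((↑) : ℝ → ℂ) '' Set.Icc (0 : ℝ) 8) (m : ℤ) :
    P₀ z (-m) = P₀ z m := by
  simp only [P₀, P, add_zero, sub_zero]
  rw [G_neg_left hz, G_neg_right hz]
  congr 1
  rw [zpow_neg, ← inv_zpow]; norm_num

theorem Q_comm {z : ℂ} (hz : z ∉ ((↑) : ℝ → ℂ) '' Set.Icc (0 : ℝ) 8) (m l : ℤ) :
    Q z m l = Q z l m := by
  simp only [Q]
  rw [add_comm m l, ← G_neg_right hz, neg_sub]

/-- The sites for l = -1 and l = 0 are exchanged by swapping the coordinates, while the sign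
changes. This closes the equation for Q along the edge l = 0. -/
theorem Q_reflect {z : ℂ} (hz : z ∉ ((↑) : ℝ → ℂ) '' Set.Icc (0 : ℝ) 8) (m : ℤ) :
    Q z m (-1) = -Q z m 0 := by
  simp only [Q]
  rw [G_swap hz, show m - -1 = m + 0 + 1 by ring, show m + -1 + 1 = m - 0 by ring, add_zero,
    ← sub_eq_add_neg, neg_one_zpow_sub_one]
  ring

theorem P_zero_right (z : ℂ) (m : ℤ) : P z m 0 = P₀ z m := rfl

/-- All four corners around the source equal ±Q(0,0), with signs that add up; the source contributes
the -1 and eventually the first term of the formula for Q. -/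
theorem Q_zero_zero {z : ℂ} (hz : z ∉ ((↑) : ℝ → ℂ) '' Set.Icc (0 : ℝ) 8) :
    4 * Q z 0 0 = (4 - z) * P₀ z 0 - 1 := by
  have h := Q_diff hz 0 0
  have h2 : Q z (-1) (-1) = Q z 0 0 := by
    rw [Q_reflect hz, Q_comm hz, Q_reflect hz, neg_neg]
  rw [zero_sub, Q_comm hz (-1) 0, h2, Q_reflect hz, P_zero_right] at h
  simp only [and_self, if_true] at h
  linear_combination h

theorem Q_succ_zero {z : ℂ} (hz : z ∉ ((↑) : ℝ → ℂ) '' Set.Icc (0 : ℝ) 8) (m : ℕ) :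
    2 * (Q z (m + 1) 0 - Q z m 0) = (4 - z) * P₀ z (m + 1) := by
  have h := Q_diff hz (m + 1) 0
  rw [if_neg (by omega), zero_sub, add_sub_cancel_right, Q_reflect hz, Q_reflect hz,
    P_zero_right] at h
  linear_combination h

theorem cV_zero_succ (p : ℕ → ℂ) (m : ℕ) : cV p 0 (m + 1) = cV p 0 m + 2 * p (m + 1) := by
  simp only [cV, cB_zero, Finset.sum_range_succ]; ring

theorem Q_zero_right {z : ℂ} (hz : z ∉ ((↑) : ℝ → ℂ) '' Set.Icc (0 : ℝ) 8) (N m : ℕ) :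
    Q z m 0 = sQ z (fun i => P₀ z i) N m 0 := by
  rw [sQ_at_zero]
  induction m with
  | zero =>
    have := Q_zero_zero hz
    simp [cV, cB_zero]
    linear_combination this / 4
  | succ m ih =>
    have := Q_succ_zero hz m
    rw [cV_zero_succ]
    push_cast
    linear_combination ih + this / 2

/-- The diagonal values determine `P` and `Q`. -/
theorem P_Q_eq_sum {z : ℂ} (hz : z ∉ ((↑) : ℝ → ℂ) '' Set.Icc (0 : ℝ) 8) (N m : ℕ) (h : m ≤ N)
    (l : ℕ) : P z m l = sP z (fun i => P₀ z i) N m l ∧ Q z m l = sQ z (fun i => P₀ z i) N m l := by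
  induction m generalizing l with
  | zero =>
    rw [sP_comm, sQ_comm, ← Q_zero_right hz, sP_at_zero]
    exact ⟨P_comm hz _ _, Q_comm hz _ _⟩
  | succ m ih =>
    induction l with
    | zero =>
      rw [← Q_zero_right hz, sP_at_zero]
      exact ⟨rfl, rfl⟩
    | succ l ihl =>
      -- Three corners of the square are known. The equation for P gives its fourth corner from Q at
      -- (m, l); the equation for Q then uses this new value of P.
      have i1 := ih (by omega) l
      have i2 := ih (by omega) (l + 1)
      have h1 := P_diff hz m l
      have h2 := sP_diff z (fun i => P₀ z i) (N := N) (m := m) l (by omega)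
      have h3 := Q_diff hz (m + 1) (l + 1)
      have h4 := sQ_diff z (fun i => P₀ z i) (N := N) (m := m) l (by omega)
      rw [if_neg (by omega), add_sub_cancel_right, add_sub_cancel_right] at h3
      push_cast at *
      have hP : P z (m + 1) (l + 1) = sP z (fun i => P₀ z i) N (m + 1) (l + 1) := by
        linear_combination h1 - h2 + ihl.1 + i2.1 - i1.1 + (4 - z) * i1.2
      refine ⟨hP, ?_⟩
      linear_combination h3 - h4 + ihl.2 + i2.2 - i1.2 + (4 - z) * hP

theorem sum_Icc_one_eq_range (f : ℕ → ℂ) (m : ℕ) :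
    ∑ μ ∈ Finset.Icc 1 m, f μ = ∑ i ∈ Finset.range m, f (i + 1) := by
  rw [Finset.range_eq_Ico, Finset.sum_Ico_add' f 0 m 1]
  rfl

theorem sum_Icc_neg_eq_range (f : ℤ → ℂ) (hf : ∀ n, f (-n) = f n) (m : ℕ) :
    ∑ μ ∈ Finset.Icc (-(m : ℤ)) m, f μ = f 0 + 2 * ∑ i ∈ Finset.range m, f ((i : ℤ) + 1) := by
  induction m with
  | zero => simp
  | succ m ih =>
    rw [Finset.sum_range_succ, mul_add, ← add_assoc, ← ih]
    have e : Finset.Icc (-((m + 1 : ℕ) : ℤ)) ((m + 1 : ℕ) : ℤ) =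
        insert (-((m : ℤ) + 1)) (insert ((m : ℤ) + 1) (Finset.Icc (-(m : ℤ)) m)) := by
      ext x; simp; omega
    rw [e, Finset.sum_insert (by simp; omega), Finset.sum_insert (by simp), hf]
    ring

theorem P_formula {z : ℂ} (hz : z ∉ ((↑) : ℝ → ℂ) '' Set.Icc (0 : ℝ) 8) (m l : ℕ) :
    P z m l =
          (z - 4) / 4 * (m * l) *
            pFq [1 + m, 1 - m, 1 + l, 1 - l] [1, 3 / 2, 3 / 2] ((z - 4) ^ 2 / 16)
        + P₀ z 0 *
            pFq [m, -m, l, -l] [1, 1 / 2, 1 / 2] ((z - 4) ^ 2 / 16)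
        + ∑ μ ∈ Finset.Icc 1 m, (P₀ z μ - P₀ z ((μ : ℤ) - 1)) *
            pFq [1 + m - μ, μ - m, l, -l] [1, 1 / 2, 1 / 2] ((z - 4) ^ 2 / 16)
        + ∑ ν ∈ Finset.Icc 1 l, (P₀ z ν - P₀ z ((ν : ℤ) - 1)) *
            pFq [m, -m, 1 + l - ν, ν - l] [1, 1 / 2, 1 / 2] ((z - 4) ^ 2 / 16) := by
  rw [(P_Q_eq_sum hz m m le_rfl l).1]
  simp only [sP, tP, add_mul, Finset.sum_add_distrib]
  congr 1
  congr 1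
  congr 1
  -- For m = 0 the series need not terminate (it does not for l = 0), but its prefactor is zero.
  · rcases m with _ | m
    · simp [cC_at_zero]
    rw [pFq_eq_sum_range (n := m) (N := m + 1 + 1) _ _ (by simp) (by omega), Finset.mul_sum]
    refine Finset.sum_congr rfl fun k _ => ?_
    have h1 := factorial_ne k
    have h2 := poch_three_halves_ne_zero k
    simp [pFqTerm, cC, poch_one]
    field_simp
  · rw [pFq_eq_sum_range (n := m) (N := m + 1) _ _ (by simp) (by omega), Finset.mul_sum]
    refine Finset.sum_congr rfl fun k _ => ?_
    have h1 := factorial_ne k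
    have h2 := poch_half_ne_zero k
    simp only [one_div] at h2
    simp [pFqTerm, cA, poch_one]
    field_simp
  · rw [sum_Icc_one_eq_range]
    simp only [cU, Finset.sum_mul]
    rw [Finset.sum_comm]
    refine Finset.sum_congr rfl fun i hi => ?_
    have hi := Finset.mem_range.1 hi
    -- With μ = i + 1 the terminating parameter is -(m-1-i); the range is padded with zeros to match
    -- the other terms.
    rw [pFq_eq_sum_range (n := m - 1 - i) (N := m + 1) _ _ _ (by omega), Finset.mul_sum]
    · refine Finset.sum_congr rfl fun k _ => ?_
      have h1 := factorial_ne k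
      have h2 := poch_half_ne_zero k
      have e1 : (1 + m - (i + 1) : ℂ) = m - i := by ring
      have e2 : (i + 1 - m : ℂ) = i - (m - 1) := by ring
      have e3 : (1 + (m - 1 - i) : ℂ) = m - i := by ring
      simp only [one_div] at h2
      simp [pFqTerm, cB, cA, poch_one, e1, e2, e3]
      field_simp
    · rw [← cast_sub_one_sub hi]
      have e2 : (-(m - 1 - i) : ℂ) = (i + 1 - m : ℂ) := by ring
      simp [e2]
  · rw [sum_Icc_one_eq_range]
    simp only [cU, Finset.sum_mul, Finset.mul_sum]
    rw [Finset.sum_comm]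
    refine Finset.sum_congr rfl fun i _ => ?_
    rw [pFq_eq_sum_range (n := m) (N := m + 1) _ _ (by simp) (by omega), Finset.mul_sum]
    refine Finset.sum_congr rfl fun k _ => ?_
    have h1 := factorial_ne k
    have h2 := poch_half_ne_zero k
    have e1 : (1 + l - (i + 1) : ℂ) = l - i := by ring
    have e2 : (i + 1 - l : ℂ) = i - (l - 1) := by ring
    have e3 : (1 + (l - 1 - i) : ℂ) = l - i := by ring
    simp only [one_div] at h2
    simp [pFqTerm, cB, cA, poch_one, e1, e2, e3]
    field_simp

theorem sum_P₀_eq_cV {z : ℂ} (hz : z ∉ ((↑) : ℝ → ℂ) '' Set.Icc (0 : ℝ) 8) (k m : ℕ) :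
    ∑ μ ∈ Finset.Icc (-(m : ℤ)) m, P₀ z μ * cB k (m - (|μ| : ℤ)) = cV (fun i => P₀ z i) k m := by
  rw [sum_Icc_neg_eq_range _ (by simp [P₀_neg hz])]
  simp only [cV, abs_zero, Int.cast_zero, sub_zero, Nat.cast_zero]
  congr 2
  refine Finset.sum_congr rfl fun i _ => ?_
  rw [abs_of_nonneg (by omega)]
  push_cast
  congr 2
  ring

theorem Q_formula {z : ℂ} (hz : z ∉ ((↑) : ℝ → ℂ) '' Set.Icc (0 : ℝ) 8) (m l : ℕ) :
    Q z m l =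
          -(1 / 4) *
            pFq [1 + m, -m, 1 + l, -l] [1, 1 / 2, 1 / 2] ((z - 4) ^ 2 / 16)
        + (z - 4) / 4 * (2 * m + 1) * (2 * l + 1) * P₀ z 0 *
            pFq [1 + m, -m, 1 + l, -l] [1, 3 / 2, 3 / 2] ((z - 4) ^ 2 / 16)
        - (z - 4) / 4 * (2 * l + 1) *
            ∑ μ ∈ Finset.Icc (-(m : ℤ)) m, P₀ z μ *
              pFq [1 + m - (|μ| : ℤ), (|μ| : ℤ) - m, 1 + l, -l] [1, 1 / 2, 3 / 2]
                ((z - 4) ^ 2 / 16)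
        - (z - 4) / 4 * (2 * m + 1) *
            ∑ ν ∈ Finset.Icc (-(l : ℤ)) l, P₀ z ν *
              pFq [1 + m, -m, 1 + l - (|ν| : ℤ), (|ν| : ℤ) - l] [1, 1 / 2, 3 / 2]
                ((z - 4) ^ 2 / 16) := by
  rw [(P_Q_eq_sum hz m m le_rfl l).2]
  simp only [sQ, tQ]
  generalize (z - 4) ^ 2 / 16 = w
  generalize (z - 4) / 4 = c
  simp only [add_mul, mul_sub, sub_mul, Finset.sum_add_distrib, Finset.sum_sub_distrib]
  rw [← add_sub_assoc, ← add_sub_assoc]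
  congr 1
  · congr 1
    · congr 1
      · rw [pFq_eq_sum_range (n := m) (N := m + 1) _ _ (by simp) (by omega), Finset.mul_sum]
        refine Finset.sum_congr rfl fun k _ => ?_
        have h1 := factorial_ne k
        have h2 := poch_half_ne_zero k
        simp only [one_div] at h2
        simp [pFqTerm, cB, poch_one]
        field_simp
      · rw [pFq_eq_sum_range (n := m) (N := m + 1) _ _ (by simp) (by omega), Finset.mul_sum]
        refine Finset.sum_congr rfl fun k _ => ?_
        have h1 := factorial_ne k
        have h2 := poch_three_halves_ne_zero k
        simp [pFqTerm, cD, poch_one]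
        field_simp
    · simp only [← sum_P₀_eq_cV hz, Finset.sum_mul, Finset.mul_sum]
      rw [Finset.sum_comm]
      refine Finset.sum_congr rfl fun μ hμ => ?_
      have hi := Finset.mem_Icc.1 hμ
      have hi' : μ.natAbs ≤ m := by omega
      rw [pFq_eq_sum_range (n := m - μ.natAbs) (N := m + 1) _ _ _ (by omega), Finset.mul_sum,
        Finset.mul_sum]
      · refine Finset.sum_congr rfl fun k _ => ?_
        have h1 := factorial_ne k
        have h2 := poch_half_ne_zero k
        have h3 := poch_three_halves_ne_zero k
        simp only [one_div] at h2
        simp [pFqTerm, cB, cD, poch_one, ← add_sub_assoc]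
        field_simp
      · rw [Nat.cast_sub hi', Nat.cast_natAbs]
        simp
  · simp only [← sum_P₀_eq_cV hz, Finset.mul_sum, Finset.sum_mul]
    rw [Finset.sum_comm]
    refine Finset.sum_congr rfl fun μ _ => ?_
    rw [pFq_eq_sum_range (n := m) (N := m + 1) _ _ (by simp) (by omega), Finset.mul_sum,
      Finset.mul_sum]
    refine Finset.sum_congr rfl fun k _ => ?_
    have h1 := factorial_ne k
    have h2 := poch_half_ne_zero k
    have h3 := poch_three_halves_ne_zero k
    simp only [one_div] at h2
    simp [pFqTerm, cB, cD, poch_one, ← add_sub_assoc]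
    field_simp

end SquareLattice

end

/-! ### Diagonal values as single integrals -/

noncomputable section

namespace SquareLattice

open MeasureTheory Complex intervalIntegral

/-- With ζ = e^{iβ} this is Cauchy's integral of 1/(ζ - q) over the unit circle, which encloses q.
-/
theorem integral_inv_one_sub_mul_exp_neg {q : ℂ} (hq : ‖q‖ < 1) :
    ∫ β in -Real.pi..Real.pi, (1 - q * exp (-(β * I)))⁻¹ = 2 * (Real.pi : ℂ) := by
  have hper : Function.Periodic (fun β : ℝ => (1 - q * exp (-(β * I)))⁻¹) (2 * Real.pi) := by
    intro β
    have : exp (-(((β + 2 * Real.pi : ℝ) : ℂ) * I)) = exp (-(β * I)) := by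
      rw [exp_neg, exp_neg]; push_cast; rw [add_mul, exp_add, exp_two_pi_mul_I, mul_one]
    simp only [this]
  have h1 := hper.intervalIntegral_add_eq (-Real.pi) 0
  rw [show -Real.pi + 2 * Real.pi = Real.pi by ring, zero_add] at h1
  rw [h1]
  have h2 := circleIntegral.integral_sub_inv_of_mem_ball (c := 0) (w := q) (R := 1)
    (by simpa using hq)
  rw [circleIntegral] at h2
  have h3 : ∀ β : ℝ, deriv (circleMap 0 1) β • (circleMap 0 1 β - q)⁻¹ =
      I * (1 - q * exp (-(β * I)))⁻¹ := by
    intro β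
    have he := exp_ne_zero (β * I)
    have : exp (β * I) - q = exp (β * I) * (1 - q * exp (-(β * I))) := by
      rw [exp_neg]; field_simp
    simp only [deriv_circleMap, circleMap, ofReal_one, one_mul, zero_add, smul_eq_mul]
    rw [this, mul_inv]
    field_simp
  simp only [h3] at h2
  rw [intervalIntegral.integral_const_mul] at h2
  have hI := I_ne_zero
  apply mul_left_cancel₀ hI
  rw [h2]; ring

theorem one_sub_mul_exp_ne_zero {q : ℂ} (hq : ‖q‖ < 1) (β : ℝ) : 1 - q * exp (β * I) ≠ 0 := by
  intro h
  have : ‖q * exp (β * I)‖ = 1 := by rw [← sub_eq_zero.1 h, norm_one]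
  rw [norm_mul, norm_exp_ofReal_mul_I, mul_one] at this
  exact hq.ne this

/-- The total mass of the Poisson kernel with a complex parameter. -/
theorem integral_poisson {q : ℂ} (hq : ‖q‖ < 1) :
    ∫ β in -Real.pi..Real.pi, (1 - q ^ 2) / (1 + q ^ 2 - 2 * q * cos (β : ℂ)) = 2 * (Real.pi : ℂ) := by
  have e : ∀ β : ℝ, exp (-(β * I)) = exp ((-β : ℝ) * I) := by intro β; push_cast; ring_nf
  -- Partial fractions in e^{iβ}: each resulting inverse has integral 2π.
  have hsplit : ∀ β : ℝ, (1 - q ^ 2) / (1 + q ^ 2 - 2 * q * cos (β : ℂ)) =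
      (1 - q * exp (β * I))⁻¹ + (1 - q * exp (-(β * I)))⁻¹ - 1 := by
    intro β
    have h1 := one_sub_mul_exp_ne_zero hq β
    have h2 := one_sub_mul_exp_ne_zero hq (-β)
    rw [← e] at h2
    have hprod : exp (β * I) * exp (-(β * I)) = 1 := by rw [← exp_add]; simp
    have hcos : 2 * cos (β : ℂ) = exp (β * I) + exp (-(β * I)) := by rw [two_cos]; ring_nf
    have h3 : 1 + q ^ 2 - 2 * q * cos (β : ℂ) =
        (1 - q * exp (β * I)) * (1 - q * exp (-(β * I))) := by
      linear_combination (-q) * hcos - q ^ 2 * hprod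
    rw [h3]
    generalize exp (β * I) = E at *
    generalize exp (-(β * I)) = E' at *
    field_simp
    linear_combination q ^ 2 * hprod
  have c1 : Continuous fun β : ℝ => (1 - q * exp (β * I))⁻¹ :=
    Continuous.inv₀ (by fun_prop) (one_sub_mul_exp_ne_zero hq)
  have c2 : Continuous fun β : ℝ => (1 - q * exp (-(β * I)))⁻¹ := by
    have := c1.comp continuous_neg
    simpa only [Function.comp_def, ← e] using this
  have h0 := integral_inv_one_sub_mul_exp_neg hq
  have h0' : ∫ β in -Real.pi..Real.pi, (1 - q * exp (β * I))⁻¹ = 2 * (Real.pi : ℂ) := by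
    rw [← h0]
    have := integral_comp_neg (a := -Real.pi) (b := Real.pi)
      (fun β : ℝ => (1 - q * exp (β * I))⁻¹)
    rw [neg_neg] at this
    rw [← this]
    simp only [e]
  have c12 : Continuous fun β : ℝ => (1 - q * exp (β * I))⁻¹ + (1 - q * exp (-(β * I)))⁻¹ :=
    c1.add c2
  simp only [hsplit]
  rw [integral_sub (c12.intervalIntegrable _ _) (by simp),
    integral_add (c1.intervalIntegrable _ _) (c2.intervalIntegrable _ _), h0, h0']
  simp
  ring

/-- |σ+r|² - |σ-r|² is 4(Re σ Re r + Im σ Im r). As κ is real, imaginary parts of the relation give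
Re r Im r = Re σ Im σ, so the second product is nonnegative. -/
theorem norm_sub_lt_norm_add {σ r : ℂ} {κ : ℝ} (hσ : 0 < σ.re) (hr : 0 < r.re)
    (h : r ^ 2 = σ ^ 2 - κ ^ 2) : ‖σ - r‖ < ‖σ + r‖ := by
  have him : r.re * r.im = σ.re * σ.im := by
    have := congrArg Complex.im h
    simp [pow_two] at this
    linarith
  have h1 : 0 ≤ σ.im * r.im := by
    have : r.re * (σ.im * r.im) = σ.re * (σ.im * σ.im) := by linear_combination σ.im * him
    have h2 : 0 ≤ r.re * (σ.im * r.im) := by rw [this]; exact mul_nonneg hσ.le (mul_self_nonneg _)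
    exact nonneg_of_mul_nonneg_right h2 hr
  have h2 : 0 < σ.re * r.re := mul_pos hσ hr
  apply lt_of_pow_lt_pow_left₀ 2 (norm_nonneg _)
  rw [← normSq_eq_norm_sq, ← normSq_eq_norm_sq, normSq_apply, normSq_apply]
  simp only [sub_re, sub_im, add_re, add_im]
  nlinarith

/-- The Poisson parameter is q = κ/(σ+r), a root of κ(1+q²) = 2σq. Since q² = (σ-r)/(σ+r), the
preceding inequality places it in the unit disc. -/
theorem integral_inv_sub_mul_cos {σ r : ℂ} {κ : ℝ} (hσ : 0 < σ.re) (hr : 0 < r.re)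
    (h : r ^ 2 = σ ^ 2 - κ ^ 2) :
    ∫ β in -Real.pi..Real.pi, (σ - κ * cos (β : ℂ))⁻¹ = 2 * (Real.pi : ℂ) / r := by
  have hlt := norm_sub_lt_norm_add hσ hr h
  have hsum : σ + r ≠ 0 := by
    intro h0; rw [h0, norm_zero] at hlt; exact absurd hlt (not_lt.2 (norm_nonneg _))
  have hr0 : r ≠ 0 := by rintro rfl; simp at hr
  have hq : ‖(κ : ℂ) / (σ + r)‖ < 1 := by
    apply lt_of_pow_lt_pow_left₀ 2 zero_le_one
    have e : ((κ : ℂ) / (σ + r)) ^ 2 = (σ - r) / (σ + r) := by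
      field_simp
      linear_combination h
    rw [← norm_pow, e, norm_div, one_pow, div_lt_one (norm_pos_iff.2 hsum)]
    exact hlt
  have key := integral_poisson hq
  have : ∀ β : ℝ, (σ - κ * cos (β : ℂ))⁻¹ = r⁻¹ * ((1 - ((κ : ℂ) / (σ + r)) ^ 2) /
      (1 + ((κ : ℂ) / (σ + r)) ^ 2 - 2 * ((κ : ℂ) / (σ + r)) * cos (β : ℂ))) := by
    intro β
    have e1 : 1 - ((κ : ℂ) / (σ + r)) ^ 2 = 2 * r / (σ + r) := by
      field_simp
      linear_combination -h
    have e2 : 1 + ((κ : ℂ) / (σ + r)) ^ 2 - 2 * ((κ : ℂ) / (σ + r)) * cos (β : ℂ) =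
        2 / (σ + r) * (σ - κ * cos (β : ℂ)) := by
      field_simp
      linear_combination h
    rw [e1, e2]
    -- At a zero of the denominator both sides are 0 by the convention for inverses, so no separate
    -- nonvanishing proof is needed.
    by_cases h0 : σ - κ * cos (β : ℂ) = 0
    · simp [h0]
    · field_simp
  simp only [this]
  rw [intervalIntegral.integral_const_mul, key]
  field_simp

/-- The diagonal integrals `∫ e^{imφ} (y + sin²(φ/2))^e dφ`. -/
def diagInt (m : ℤ) (e y : ℂ) : ℂ :=
  ∫ φ in -Real.pi..Real.pi, exp (I * m * φ) * (y + (1 - cos (φ : ℂ)) / 2) ^ e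

theorem add_nonneg_mem_slitPlane {y : ℂ} (hy : y ∈ slitPlane) {t : ℝ} (ht : 0 ≤ t) :
    y + t ∈ slitPlane := by
  rw [mem_slitPlane_iff] at hy ⊢
  rcases hy with hy | hy
  · left; simp; linarith
  · right; simpa using hy

theorem base_mem_slitPlane {y : ℂ} (hy : y ∈ slitPlane) (φ : ℝ) :
    y + (1 - cos (φ : ℂ)) / 2 ∈ slitPlane := by
  have := add_nonneg_mem_slitPlane hy (t := (1 - Real.cos φ) / 2)
    (by linarith [Real.cos_le_one φ])
  push_cast at this
  exact this

/-- The principal root halves an argument in (-π, π). This makes it the admissible choice of r. -/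
theorem cpow_half_re_pos {D : ℂ} (hD : D ∈ slitPlane) : 0 < (D ^ (1 / 2 : ℂ)).re := by
  have h0 := slitPlane_ne_zero hD
  rw [cpow_def_of_ne_zero h0, exp_re]
  apply mul_pos (Real.exp_pos _)
  have him : (log D * (1 / 2)).im = D.arg / 2 := by
    rw [show log D * (1 / 2) = log D / (2 : ℝ) by push_cast; ring, div_ofReal_im, log_im]
  rw [him]
  apply Real.cos_pos_of_mem_Ioo
  have h1 := neg_pi_lt_arg D
  have h2 := lt_of_le_of_ne (arg_le_pi D) (mem_slitPlane_iff_arg.1 hD).1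
  constructor <;> linarith

/-- Negating σ and κ reduces the case Re σ < 0 to the previous one while r keeps its branch; this is
the source of the sign ± in the theorem. -/
theorem integral_inv_sub_mul_cos_sign {ε σ r : ℂ} {κ : ℝ} (hε : ε = 1 ∨ ε = -1)
    (hσ : 0 < (ε * σ).re) (hr : 0 < r.re) (h : r ^ 2 = σ ^ 2 - κ ^ 2) :
    ∫ β in -Real.pi..Real.pi, (σ - κ * cos (β : ℂ))⁻¹ = ε * (2 * Real.pi / r) := by
  rcases hε with rfl | rfl
  · rw [one_mul] at *
    exact integral_inv_sub_mul_cos hσ hr h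
  · rw [← integral_inv_sub_mul_cos (κ := -κ) hσ hr (by push_cast; linear_combination h),
      ← intervalIntegral.integral_const_mul]
    refine integral_congr fun β _ => ?_
    rw [show -1 * σ - ((-κ : ℝ) : ℂ) * cos (β : ℂ) = -(σ - κ * cos (β : ℂ)) by push_cast; ring,
      inv_neg]
    ring

/-- Diagonal values of the kernel as single integrals. -/
theorem G_diag {z : ℂ} (hz : z ∉ ((↑) : ℝ → ℂ) '' Set.Icc (0 : ℝ) 8) {ε : ℂ}
    (hε : ε = 1 ∨ ε = -1) (hre : 0 < (ε * (4 - z)).re) (hy : z * (z - 8) / 16 ∈ slitPlane) (m : ℤ) :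
    G z ![m, m] = ε / (8 * Real.pi) * diagInt m (-(1 / 2)) (z * (z - 8) / 16) := by
  have hpi : (Real.pi : ℂ) ≠ 0 := by exact_mod_cast Real.pi_ne_zero
  rw [G_eq_torusInt hz]
  -- Shear to φ = x + y; periodicity returns the shifted interval to [-π, π].
  have h1 : torusInt (kern z m m) = torusInt (fun x φ => kern z m m x (φ - x)) := by
    unfold torusInt
    refine integral_congr fun x _ => ?_
    simp only
    have hper : Function.Periodic (kern z m m x) (2 * Real.pi) := by
      intro y
      simp only [kern]
      congr 1
      · push_cast
        rw [show I * (m * x + m * (y + 2 * Real.pi)) =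
          I * (m * x + m * y) + m * (2 * Real.pi * I) by ring, exp_periodic.int_mul m]
      · push_cast
        rw [cos_add_two_pi]
    rw [intervalIntegral.integral_comp_sub_right (kern z m m x)]
    have := hper.intervalIntegral_add_eq (-Real.pi) (-Real.pi - x)
    rw [show -Real.pi + 2 * Real.pi = Real.pi by ring,
      show -Real.pi - x + 2 * Real.pi = Real.pi - x by ring] at this
    exact this
  have hc : Continuous (Function.uncurry fun x φ => kern z m m x (φ - x)) :=
    (continuous_kern hz m m).comp (by fun_prop : Continuous fun p : ℝ × ℝ => (p.1, p.2 - p.1))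
  rw [h1, ← torusInt_swap hc]
  have h2 : ∀ φ : ℝ, ∫ x in -Real.pi..Real.pi, kern z m m x (φ - x) =
      ε * (Real.pi / 2) * (exp (I * m * φ) * (z * (z - 8) / 16 + (1 - cos (φ : ℂ)) / 2) ^
        (-(1 / 2) : ℂ)) := by
    intro φ
    have hD := base_mem_slitPlane hy φ
    have hκ : ((Real.cos (φ / 2) : ℝ) : ℂ) ^ 2 = (1 + cos (φ : ℂ)) / 2 := by
      push_cast; rw [cos_sq]; rw [mul_div_cancel₀ _ (by norm_num : (2 : ℂ) ≠ 0)]; ring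
    -- With σ = (4-z)/4 one has σ² = 1 + y, and κ² = (1 + cos φ)/2, so σ² - κ² = y + sin²(φ/2).
    have key := integral_inv_sub_mul_cos_sign (σ := (4 - z) / 4) (κ := Real.cos (φ / 2)) hε
      (by
        rw [← mul_div_assoc, show (4 : ℂ) = (4 : ℝ) by norm_num, div_ofReal_re]
        simpa using hre) (cpow_half_re_pos hD) (by
        rw [hκ, ← cpow_nat_mul]
        norm_num
        ring)
    have h3 : ∀ x : ℝ, kern z m m x (φ - x) = exp (I * m * φ) / 4 *
        ((4 - z) / 4 - (Real.cos (φ / 2) : ℝ) * cos ((x - φ / 2 : ℝ) : ℂ))⁻¹ := by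
      intro x
      simp only [kern]
      have e1 : I * (m * x + m * ((φ - x : ℝ) : ℂ)) = I * m * φ := by push_cast; ring
      have e2 : 2 * cos (x : ℂ) + 2 * cos ((φ - x : ℝ) : ℂ) =
          4 * ((Real.cos (φ / 2) : ℝ) * cos ((x - φ / 2 : ℝ) : ℂ)) := by
        have := cos_add_cos (x : ℂ) ((φ - x : ℝ) : ℂ)
        rw [← mul_add, this]
        push_cast
        ring_nf
      rw [e1, show 4 - z - 2 * cos (x : ℂ) - 2 * cos ((φ - x : ℝ) : ℂ) =
        4 * ((4 - z) / 4 - (Real.cos (φ / 2) : ℝ) * cos ((x - φ / 2 : ℝ) : ℂ)) by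
          linear_combination -e2, div_mul_eq_div_div, div_eq_mul_inv _ (_ - _)]
    simp only [h3]
    rw [intervalIntegral.integral_const_mul, intervalIntegral.integral_comp_sub_right
      (fun x : ℝ => ((4 - z) / 4 - (Real.cos (φ / 2) : ℝ) * cos (x : ℂ))⁻¹)]
    have hper : Function.Periodic
        (fun x : ℝ => ((4 - z) / 4 - (Real.cos (φ / 2) : ℝ) * cos (x : ℂ))⁻¹) (2 * Real.pi) := by
      intro x
      simp only
      push_cast
      rw [cos_add_two_pi]
    have := hper.intervalIntegral_add_eq (-Real.pi) (-Real.pi - φ / 2)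
    rw [show -Real.pi + 2 * Real.pi = Real.pi by ring,
      show -Real.pi - φ / 2 + 2 * Real.pi = Real.pi - φ / 2 by ring] at this
    rw [← this, key, cpow_neg]
    ring
  unfold torusInt diagInt
  simp only [h2]
  rw [intervalIntegral.integral_const_mul]
  push_cast
  field_simp
  ring

/-- The imaginary part of z(z-8) is 2(Re z - 4) Im z. A real nonpositive value with Re z ≠ 4
therefore forces z to be real and in [0, 8]. -/
theorem mem_slitPlane_of_re_ne {z : ℂ} (hz : z ∉ ((↑) : ℝ → ℂ) '' Set.Icc (0 : ℝ) 8)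
    (hre : (4 - z).re ≠ 0) : z * (z - 8) / 16 ∈ slitPlane := by
  by_contra h
  rw [mem_slitPlane_iff, not_or, not_lt, not_not] at h
  obtain ⟨h1, h2⟩ := h
  rw [show (16 : ℂ) = (16 : ℝ) by norm_num] at h1 h2
  rw [div_ofReal_re] at h1
  rw [div_ofReal_im] at h2
  simp at h1 h2 hre
  have hre' : z.re - 4 ≠ 0 := fun h => hre (by linarith)
  have him : z.im = 0 := by
    have : (z.re - 4) * z.im = 0 := by linarith
    exact (mul_eq_zero.1 this).resolve_left hre'
  rw [him] at h1
  apply hz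
  refine ⟨z.re, ⟨?_, ?_⟩, ?_⟩
  · nlinarith
  · nlinarith
  · apply Complex.ext <;> simp [him]

end SquareLattice

end

/-! ### The diagonal integral: differential equation and behaviour as y ↓ 0 -/

noncomputable section

namespace SquareLattice

open MeasureTheory Complex intervalIntegral Filter Topology

theorem continuousOn_diagInt_integrand (m : ℤ) (e : ℂ) :
    ContinuousOn (fun p : ℂ × ℝ => exp (I * m * p.2) * (p.1 + (1 - cos (p.2 : ℂ)) / 2) ^ e)
      (slitPlane ×ˢ Set.univ) := by
  apply ContinuousOn.mul
  · fun_prop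
  · exact ContinuousOn.cpow_const (by fun_prop) fun p hp => base_mem_slitPlane hp.1 p.2

theorem continuous_diagInt_integrand {y : ℂ} (hy : y ∈ slitPlane) (m : ℤ) (e : ℂ) :
    Continuous fun φ : ℝ => exp (I * m * φ) * (y + (1 - cos (φ : ℂ)) / 2) ^ e := by
  apply Continuous.mul
  · fun_prop
  · refine continuous_iff_continuousAt.2 fun φ => ?_
    exact ContinuousAt.cpow (by fun_prop) (by fun_prop) (base_mem_slitPlane hy φ)

/-- Differentiation under the integral, dominated on a compact ball inside the slit plane. The
exponents -1/2, -3/2, -5/2 thus encode J, J' and J'' up to constants. -/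
theorem hasDerivAt_diagInt {y : ℂ} (hy : y ∈ slitPlane) (m : ℤ) (e : ℂ) :
    HasDerivAt (diagInt m e) (e * diagInt m (e - 1) y) y := by
  obtain ⟨r, hr, hball⟩ := Metric.nhds_basis_closedBall.mem_iff.1
    (isOpen_slitPlane.mem_nhds hy)
  have hcpt : IsCompact (Metric.closedBall y r ×ˢ Set.Icc (-Real.pi) Real.pi) :=
    (isCompact_closedBall y r).prod isCompact_Icc
  obtain ⟨C, hC⟩ := hcpt.exists_bound_of_continuousOn
    ((continuousOn_diagInt_integrand m (e - 1)).mono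
      (Set.prod_mono hball (Set.subset_univ _)))
  have key := intervalIntegral.hasDerivAt_integral_of_dominated_loc_of_deriv_le
    (μ := volume) (a := -Real.pi) (b := Real.pi)
    (F := fun x φ => exp (I * m * φ) * (x + (1 - cos (φ : ℂ)) / 2) ^ e)
    (F' := fun x φ => e * (exp (I * m * φ) * (x + (1 - cos (φ : ℂ)) / 2) ^ (e - 1)))
    (bound := fun _ => ‖e‖ * C) (x₀ := y) (Metric.closedBall_mem_nhds y hr)
    (by
      filter_upwards [isOpen_slitPlane.mem_nhds hy] with x hx
      exact (continuous_diagInt_integrand hx m e).aestronglyMeasurable)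
    ((continuous_diagInt_integrand hy m e).intervalIntegrable _ _)
    ((continuous_diagInt_integrand hy m (e - 1)).const_mul e).aestronglyMeasurable
    (by
      refine Eventually.of_forall fun φ hφ x hx => ?_
      rw [Set.uIoc_of_le (by linarith [Real.pi_pos])] at hφ
      rw [norm_mul]
      exact mul_le_mul_of_nonneg_left (hC (x, φ) ⟨hx, Set.Ioc_subset_Icc_self hφ⟩) (norm_nonneg _))
    (by simp)
    (by
      refine Eventually.of_forall fun φ _ x hx => ?_
      have h1 := ((hasDerivAt_id x).add_const ((1 - cos (φ : ℂ)) / 2)).cpow_const (c := e)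
        (base_mem_slitPlane (hball hx) φ)
      have h2 := h1.const_mul (exp (I * m * φ))
      refine h2.congr_deriv ?_
      simp only [id]
      ring)
  have h := key.2
  rw [intervalIntegral.integral_const_mul] at h
  exact h

/-- The hypergeometric differential equation of the diagonal values. -/
theorem diagInt_ode {y : ℂ} (hy : y ∈ slitPlane) (m : ℤ) :
    3 / 4 * (y * (1 + y)) * diagInt m (-(5 / 2)) y - 1 / 2 * (1 + 2 * y) * diagInt m (-(3 / 2)) y +
      (1 / 4 - m ^ 2) * diagInt m (-(1 / 2)) y = 0 := by
  have c := fun e => (continuous_diagInt_integrand hy m e)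
  -- The combined integrand is the exact derivative of a 2π-periodic function, so its integral over
  -- a period vanishes. Reducing every power to exponent -5/2 leaves an identity modulo sin² + cos²
  -- = 1 and I² = -1.
  have key : ∀ φ : ℝ, HasDerivAt (fun φ : ℝ => exp (I * m * φ) *
      (I * m * (y + (1 - cos (φ : ℂ)) / 2) ^ (-(1 / 2) : ℂ) +
        1 / 4 * sin (φ : ℂ) * (y + (1 - cos (φ : ℂ)) / 2) ^ (-(3 / 2) : ℂ)))
      (3 / 4 * (y * (1 + y)) * (exp (I * m * φ) * (y + (1 - cos (φ : ℂ)) / 2) ^ (-(5 / 2) : ℂ)) -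
        1 / 2 * (1 + 2 * y) * (exp (I * m * φ) * (y + (1 - cos (φ : ℂ)) / 2) ^ (-(3 / 2) : ℂ)) +
        (1 / 4 - m ^ 2) * (exp (I * m * φ) * (y + (1 - cos (φ : ℂ)) / 2) ^ (-(1 / 2) : ℂ))) φ := by
    intro φ
    have hD := base_mem_slitPlane hy φ
    have hD0 := slitPlane_ne_zero hD
    have dD : HasDerivAt (fun x : ℂ => y + (1 - cos x) / 2) (sin (φ : ℂ) / 2) φ := by
      have := (((hasDerivAt_cos (φ : ℂ)).const_sub 1).div_const 2).const_add y
      simpa using this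
    have dE : HasDerivAt (fun x : ℂ => exp (I * m * x)) (exp (I * m * φ) * (I * m)) φ := by
      have := ((hasDerivAt_id (φ : ℂ)).const_mul (I * m)).cexp
      simpa using this
    have d1 := dD.cpow_const (c := (-(1 / 2) : ℂ)) hD
    have d3 := dD.cpow_const (c := (-(3 / 2) : ℂ)) hD
    have d := (dE.mul ((d1.const_mul (I * m)).add
      (((hasDerivAt_sin (φ : ℂ)).const_mul (1 / 4)).mul d3))).comp_ofReal
    refine HasDerivAt.congr_deriv d ?_
    simp only [Pi.add_apply, Pi.mul_apply]
    have hs := sin_sq_add_cos_sq (φ : ℂ)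
    have e1 : (y + (1 - cos (φ : ℂ)) / 2) ^ (-(1 / 2) - 1 : ℂ) =
        (y + (1 - cos (φ : ℂ)) / 2) * (y + (1 - cos (φ : ℂ)) / 2) ^ (-(5 / 2) : ℂ) := by
      nth_rw 2 [← cpow_one (y + (1 - cos (φ : ℂ)) / 2)]
      rw [← cpow_add _ _ hD0]; norm_num
    have e2 : (y + (1 - cos (φ : ℂ)) / 2) ^ (-(3 / 2) : ℂ) =
        (y + (1 - cos (φ : ℂ)) / 2) * (y + (1 - cos (φ : ℂ)) / 2) ^ (-(5 / 2) : ℂ) := by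
      rw [← e1]; norm_num
    have e3 : (y + (1 - cos (φ : ℂ)) / 2) ^ (-(1 / 2) : ℂ) =
        (y + (1 - cos (φ : ℂ)) / 2) ^ 2 * (y + (1 - cos (φ : ℂ)) / 2) ^ (-(5 / 2) : ℂ) := by
      rw [← cpow_ofNat, ← cpow_add _ _ hD0]; norm_num
    have e4 : (-(3 / 2) - 1 : ℂ) = -(5 / 2) := by norm_num
    rw [e4, e1, e2, e3]
    generalize (y + (1 - cos (φ : ℂ)) / 2) ^ (-(5 / 2) : ℂ) = T
    generalize exp (I * m * φ) = E
    generalize cos (φ : ℂ) = co at *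
    generalize sin (φ : ℂ) = si at *
    have hI := I_sq
    linear_combination (-(3 / 16) * E * T) * hs + (E * T * m ^ 2 * (y + (1 - co) / 2) ^ 2) * hI
  have hint := integral_eq_sub_of_hasDerivAt (a := -Real.pi) (b := Real.pi)
    (fun φ _ => key φ) (by
      apply Continuous.intervalIntegrable
      exact (((c _).const_mul _).sub ((c _).const_mul _)).add ((c _).const_mul _))
  have hexp : exp (I * m * Real.pi) = exp (I * m * ((-Real.pi : ℝ) : ℂ)) := by
    rw [show I * m * (Real.pi : ℂ) = I * m * ((-Real.pi : ℝ) : ℂ) + m * (2 * Real.pi * I) by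
      push_cast; ring, exp_periodic.int_mul m]
  rw [hexp, ofReal_neg] at hint
  simp only [cos_neg, sin_neg, sin_pi, neg_zero, sub_self] at hint
  have i1 := ((c (-(5 / 2))).const_mul (3 / 4 * (y * (1 + y)))).intervalIntegrable
    (μ := volume) (-Real.pi) Real.pi
  have i2 := ((c (-(3 / 2))).const_mul (1 / 2 * (1 + 2 * y))).intervalIntegrable
    (μ := volume) (-Real.pi) Real.pi
  have i3 := ((c (-(1 / 2))).const_mul (1 / 4 - (m : ℂ) ^ 2)).intervalIntegrable
    (μ := volume) (-Real.pi) Real.pi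
  rw [intervalIntegral.integral_add (i1.sub i2) i3, intervalIntegral.integral_sub i1 i2,
    intervalIntegral.integral_const_mul, intervalIntegral.integral_const_mul,
    intervalIntegral.integral_const_mul] at hint
  exact hint

/-- The weight `1 / √(y + sin²(φ/2))`. -/
def wt (y φ : ℝ) : ℝ := (√(y + Real.sin (φ / 2) ^ 2))⁻¹

theorem wt_base_pos {y : ℝ} (hy : 0 < y) (φ : ℝ) : 0 < y + Real.sin (φ / 2) ^ 2 := by positivity

theorem continuous_wt {y : ℝ} (hy : 0 < y) : Continuous (wt y) := by
  unfold wt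
  exact Continuous.inv₀ (by fun_prop) fun φ => (Real.sqrt_pos.2 (wt_base_pos hy φ)).ne'

theorem cpow_base_eq_wt {y : ℝ} (hy : 0 < y) (φ : ℝ) :
    ((y : ℂ) + (1 - cos (φ : ℂ)) / 2) ^ (-(1 / 2) : ℂ) = (wt y φ : ℂ) := by
  have h1 : (y : ℂ) + (1 - cos (φ : ℂ)) / 2 = ((y + Real.sin (φ / 2) ^ 2 : ℝ) : ℂ) := by
    have h := Real.cos_sq (φ / 2)
    rw [mul_div_cancel₀ _ (two_ne_zero)] at h
    rw [Real.sin_sq, h]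
    push_cast
    ring
  rw [h1, wt, Real.sqrt_eq_rpow, ← Real.rpow_neg (wt_base_pos hy φ).le,
    ofReal_cpow (wt_base_pos hy φ).le]
  norm_num

/-- The diagonal integrals for real positive arguments, as integrals over `[0, π]`. -/
def realDiag (m : ℤ) (y : ℝ) : ℝ := ∫ φ in (0 : ℝ)..Real.pi, 2 * Real.cos (m * φ) * wt y φ

theorem diagInt_eq_realDiag {y : ℝ} (hy : 0 < y) (m : ℤ) :
    diagInt m (-(1 / 2)) y = realDiag m y := by
  have hys : (y : ℂ) ∈ slitPlane := by simpa using hy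
  have c := continuous_diagInt_integrand hys m (-(1 / 2))
  unfold diagInt realDiag
  rw [← integral_add_adjacent_intervals (c.intervalIntegrable _ 0) (c.intervalIntegrable 0 _)]
  have h := integral_comp_neg (a := 0) (b := Real.pi)
    (fun φ : ℝ => exp (I * m * φ) * ((y : ℂ) + (1 - cos (φ : ℂ)) / 2) ^ (-(1 / 2) : ℂ))
  rw [neg_zero] at h
  have c' := c.comp continuous_neg
  simp only [Function.comp_def] at c'
  rw [← h, ← integral_add (c'.intervalIntegrable _ _) (c.intervalIntegrable _ _),
    ← intervalIntegral.integral_ofReal]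
  refine integral_congr fun φ _ => ?_
  simp only [cpow_base_eq_wt hy]
  have hw : wt y (-φ) = wt y φ := by simp [wt, neg_div]
  rw [hw]
  push_cast
  rw [two_cos, ← add_mul, add_comm]
  ring_nf

/-- Dominated convergence with a constant bound: sin(φ/2) ≤ √(y + sin²(φ/2)), so a factor of size
sin(φ/2) absorbs the singularity of the weight at φ = 0. -/
theorem tendsto_integral_mul_wt {g : ℝ → ℝ} (hg : Continuous g) {C : ℝ}
    (hC : ∀ φ ∈ Set.Ioc 0 Real.pi, |g φ| ≤ C * Real.sin (φ / 2)) :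
    Tendsto (fun y : ℝ => ∫ φ in (0 : ℝ)..Real.pi, g φ * wt y φ) (𝓝[>] 0)
      (𝓝 (∫ φ in (0 : ℝ)..Real.pi, g φ * (Real.sin (φ / 2))⁻¹)) := by
  have hsin : ∀ φ ∈ Set.Ioc 0 Real.pi, 0 < Real.sin (φ / 2) := fun φ hφ =>
    Real.sin_pos_of_pos_of_lt_pi (by linarith [hφ.1]) (by linarith [hφ.2, Real.pi_pos])
  apply intervalIntegral.tendsto_integral_filter_of_dominated_convergence (fun _ => C)
  · filter_upwards [self_mem_nhdsWithin] with y hy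
    exact (hg.mul (continuous_wt hy)).aestronglyMeasurable
  · filter_upwards [self_mem_nhdsWithin] with y hy
    refine Eventually.of_forall fun φ hφ => ?_
    rw [Set.uIoc_of_le Real.pi_pos.le] at hφ
    have hs := hsin φ hφ
    have hy' : 0 < y := hy
    have h1 : Real.sin (φ / 2) ≤ √(y + Real.sin (φ / 2) ^ 2) :=
      Real.le_sqrt_of_sq_le (by linarith)
    rw [norm_mul, Real.norm_eq_abs, Real.norm_eq_abs, wt, abs_inv, abs_of_nonneg (Real.sqrt_nonneg _),
      ← div_eq_mul_inv, div_le_iff₀ (hs.trans_le h1)]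
    refine (hC φ hφ).trans (mul_le_mul_of_nonneg_left h1 ?_)
    have := (abs_nonneg _).trans (hC φ hφ)
    exact nonneg_of_mul_nonneg_left this hs
  · simp
  · refine Eventually.of_forall fun φ hφ => ?_
    rw [Set.uIoc_of_le Real.pi_pos.le] at hφ
    have hs := hsin φ hφ
    refine (Tendsto.const_mul _ ?_).mono_left nhdsWithin_le_nhds
    have hc : ContinuousAt (fun y : ℝ => wt y φ) 0 := by
      unfold wt
      refine ContinuousAt.inv₀ (by fun_prop) ?_
      simp [hs.ne', Real.sqrt_sq_eq_abs]
    have := hc.tendsto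
    simpa [wt, Real.sqrt_sq hs.le] using this

/-- The difference of the two cosines contains the factor sin(φ/2), so increments in m stay bounded
as y ↓ 0 although each term diverges logarithmically. -/
theorem realDiag_succ_sub {y : ℝ} (hy : 0 < y) (m : ℤ) :
    realDiag (m + 1) y - realDiag m y = ∫ φ in (0 : ℝ)..Real.pi,
      (-4 * Real.sin ((m + 1 / 2) * φ) * Real.sin (φ / 2)) * wt y φ := by
  have c : ∀ n : ℤ, Continuous fun φ : ℝ => 2 * Real.cos (n * φ) * wt y φ := fun n =>
    (by fun_prop : Continuous fun φ : ℝ => 2 * Real.cos (n * φ)).mul (continuous_wt hy)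
  unfold realDiag
  rw [← integral_sub ((c _).intervalIntegrable _ _) ((c _).intervalIntegrable _ _)]
  refine integral_congr fun φ _ => ?_
  have := Real.cos_sub_cos (((m + 1 : ℤ) : ℝ) * φ) (m * φ)
  rw [← sub_mul, ← mul_sub, this]
  push_cast
  ring_nf

theorem tendsto_realDiag_succ_sub (m : ℤ) :
    Tendsto (fun y : ℝ => realDiag (m + 1) y - realDiag m y) (𝓝[>] 0)
      (𝓝 (-4 / (m + 1 / 2))) := by
  have hc : (m + 1 / 2 : ℝ) ≠ 0 := by
    intro h
    have h' : ((2 * m + 1 : ℤ) : ℝ) = 0 := by push_cast; linear_combination 2 * h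
    have h2 : 2 * m + 1 = 0 := by exact_mod_cast h'
    omega
  have h := tendsto_integral_mul_wt
    (g := fun φ => -4 * Real.sin ((m + 1 / 2) * φ) * Real.sin (φ / 2)) (by fun_prop) (C := 4) (by
      intro φ hφ
      have hs : 0 ≤ Real.sin (φ / 2) := Real.sin_nonneg_of_nonneg_of_le_pi (by linarith [hφ.1])
        (by linarith [hφ.2, Real.pi_pos])
      rw [abs_mul, abs_mul, abs_of_nonneg hs, abs_neg, abs_of_nonneg (by norm_num : (0 : ℝ) ≤ 4)]
      have := Real.abs_sin_le_one ((m + 1 / 2) * φ)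
      nlinarith)
  have hlim : ∫ φ in (0 : ℝ)..Real.pi, -4 * Real.sin ((m + 1 / 2) * φ) * Real.sin (φ / 2) *
      (Real.sin (φ / 2))⁻¹ = -4 / (m + 1 / 2) := by
    have e : ∫ φ in (0 : ℝ)..Real.pi, -4 * Real.sin ((m + 1 / 2) * φ) * Real.sin (φ / 2) *
        (Real.sin (φ / 2))⁻¹ = ∫ φ in (0 : ℝ)..Real.pi, -4 * Real.sin ((m + 1 / 2) * φ) := by
      refine integral_congr_Ioo_of_le Real.pi_pos.le fun φ hφ => ?_
      have hs : 0 < Real.sin (φ / 2) := Real.sin_pos_of_pos_of_lt_pi (by linarith [hφ.1])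
        (by linarith [hφ.2, Real.pi_pos])
      exact mul_inv_cancel_right₀ hs.ne' _
    rw [e, intervalIntegral.integral_const_mul, intervalIntegral.integral_comp_mul_left _ hc,
      integral_sin]
    have hcos : Real.cos ((m + 1 / 2) * Real.pi) = 0 := by
      rw [add_mul, Real.cos_add, Real.sin_int_mul_pi, show 1 / 2 * Real.pi = Real.pi / 2 by ring,
        Real.cos_pi_div_two]
      ring
    rw [hcos]
    simp
    field_simp
  rw [hlim] at h
  refine h.congr' ?_
  filter_upwards [self_mem_nhdsWithin] with y hy
  exact (realDiag_succ_sub hy m).symm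

/-- In the variable s = sin(φ/2) the primitive is 4 log(s + √(y+s²)). This isolates the logarithmic
singularity explicitly. -/
theorem integral_cos_mul_wt {y : ℝ} (hy : 0 < y) :
    ∫ φ in (0 : ℝ)..Real.pi, 2 * Real.cos (φ / 2) * wt y φ =
      4 * Real.log (1 + √(y + 1)) - 2 * Real.log y := by
  have hd : ∀ φ : ℝ, HasDerivAt
      (fun φ => 4 * Real.log (Real.sin (φ / 2) + √(y + Real.sin (φ / 2) ^ 2)))
      (2 * Real.cos (φ / 2) * wt y φ) φ := by
    intro φ
    have hb := wt_base_pos hy φ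
    have hq := Real.sqrt_pos.2 hb
    have hpos : 0 < Real.sin (φ / 2) + √(y + Real.sin (φ / 2) ^ 2) := by
      have : |Real.sin (φ / 2)| < √(y + Real.sin (φ / 2) ^ 2) := by
        rw [← Real.sqrt_sq_eq_abs]
        exact Real.sqrt_lt_sqrt (sq_nonneg _) (by linarith)
      linarith [neg_abs_le (Real.sin (φ / 2))]
    have ds : HasDerivAt (fun φ : ℝ => Real.sin (φ / 2)) (Real.cos (φ / 2) * (1 / 2)) φ :=
      ((hasDerivAt_id φ).div_const 2).sin
    have d := ((ds.add (((ds.pow 2).const_add y).sqrt hb.ne')).log hpos.ne').const_mul 4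
    refine HasDerivAt.congr_deriv d ?_
    simp only [wt]
    simp only [Pi.add_apply, Pi.pow_apply]
    generalize √(y + Real.sin (φ / 2) ^ 2) = q at *
    field_simp
    push_cast
    ring
  rw [integral_eq_sub_of_hasDerivAt (fun φ _ => hd φ)
    (((by fun_prop : Continuous fun φ : ℝ => 2 * Real.cos (φ / 2)).mul
      (continuous_wt hy)).intervalIntegrable _ _)]
  simp [Real.log_sqrt hy.le]
  ring

theorem integral_two_mul_one_sub_cos_div_sin :
    ∫ φ in (0 : ℝ)..Real.pi, 2 * (1 - Real.cos (φ / 2)) * (Real.sin (φ / 2))⁻¹ =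
      4 * Real.log 2 := by
  have hcos : ∀ φ ∈ Set.uIcc 0 Real.pi, 0 < Real.cos (φ / 4) := by
    intro φ hφ
    rw [Set.uIcc_of_le Real.pi_pos.le] at hφ
    apply Real.cos_pos_of_mem_Ioo
    constructor <;> linarith [hφ.1, hφ.2, Real.pi_pos]
  have e : ∫ φ in (0 : ℝ)..Real.pi, 2 * (1 - Real.cos (φ / 2)) * (Real.sin (φ / 2))⁻¹ =
      ∫ φ in (0 : ℝ)..Real.pi, 2 * (Real.sin (φ / 4) / Real.cos (φ / 4)) := by
    refine integral_congr_Ioo_of_le Real.pi_pos.le fun φ hφ => ?_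
    have hc := hcos φ (by rw [Set.uIcc_of_le Real.pi_pos.le]; exact Set.Ioo_subset_Icc_self hφ)
    have hs : 0 < Real.sin (φ / 4) := Real.sin_pos_of_pos_of_lt_pi (by linarith [hφ.1])
      (by linarith [hφ.2, Real.pi_pos])
    have h2 : φ / 2 = 2 * (φ / 4) := by ring
    simp only [h2, Real.cos_two_mul, Real.sin_two_mul]
    have := Real.sin_sq_add_cos_sq (φ / 4)
    field_simp
    linear_combination (-2) * this
  rw [e, integral_eq_sub_of_hasDerivAt (f := fun φ => -8 * Real.log (Real.cos (φ / 4)))]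
  · rw [Real.cos_pi_div_four, Real.log_div (by positivity) (by norm_num), Real.log_sqrt (by norm_num)]
    simp
    ring
  · intro φ hφ
    have d := ((((hasDerivAt_id φ).div_const 4).cos).log (hcos φ hφ).ne').const_mul (-8)
    refine HasDerivAt.congr_deriv d ?_
    simp only [id]
    ring
  · apply ContinuousOn.intervalIntegrable
    exact (ContinuousOn.div (by fun_prop) (by fun_prop) fun φ hφ => (hcos φ hφ).ne').const_mul _

/-- Write 1 = (1 - cos(φ/2)) + cos(φ/2): the first part converges by domination, the second is
explicit, and each contributes 4 log 2. -/
theorem tendsto_realDiag_zero_add_log :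
    Tendsto (fun y : ℝ => realDiag 0 y + 2 * Real.log y) (𝓝[>] 0) (𝓝 (8 * Real.log 2)) := by
  have h1 := tendsto_integral_mul_wt
    (g := fun φ => 2 * (1 - Real.cos (φ / 2))) (by fun_prop) (C := 2) (by
      intro φ hφ
      have hs : 0 ≤ Real.sin (φ / 2) := Real.sin_nonneg_of_nonneg_of_le_pi (by linarith [hφ.1])
        (by linarith [hφ.2, Real.pi_pos])
      have hc : 0 ≤ Real.cos (φ / 2) := Real.cos_nonneg_of_mem_Icc
        ⟨by linarith [hφ.1, Real.pi_pos], by linarith [hφ.2]⟩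
      have hc1 := Real.cos_le_one (φ / 2)
      rw [abs_of_nonneg (by linarith)]
      have := Real.sin_sq_add_cos_sq (φ / 2)
      nlinarith)
  rw [integral_two_mul_one_sub_cos_div_sin] at h1
  have h2 : Tendsto (fun y : ℝ => 4 * Real.log (1 + √(y + 1))) (𝓝[>] 0) (𝓝 (4 * Real.log 2)) := by
    have hc : ContinuousAt (fun y : ℝ => 4 * Real.log (1 + √(y + 1))) 0 := by
      refine ContinuousAt.mul continuousAt_const (ContinuousAt.log (by fun_prop) ?_)
      have := Real.sqrt_nonneg ((0 : ℝ) + 1)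
      linarith
    have := hc.tendsto
    simp only [zero_add, Real.sqrt_one] at this
    rw [show (1 : ℝ) + 1 = 2 by norm_num] at this
    exact this.mono_left nhdsWithin_le_nhds
  have h := h1.add h2
  rw [show 4 * Real.log 2 + 4 * Real.log 2 = 8 * Real.log 2 by ring] at h
  refine h.congr' ?_
  filter_upwards [self_mem_nhdsWithin] with y hy
  have hy' : 0 < y := hy
  have hs : realDiag 0 y = (∫ φ in (0 : ℝ)..Real.pi, 2 * (1 - Real.cos (φ / 2)) * wt y φ) +
      ∫ φ in (0 : ℝ)..Real.pi, 2 * Real.cos (φ / 2) * wt y φ := by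
    unfold realDiag
    rw [← intervalIntegral.integral_add]
    · refine integral_congr fun φ _ => ?_
      simp
      ring
    · exact ((by fun_prop : Continuous fun φ : ℝ => 2 * (1 - Real.cos (φ / 2))).mul
        (continuous_wt hy')).intervalIntegrable _ _
    · exact ((by fun_prop : Continuous fun φ : ℝ => 2 * Real.cos (φ / 2)).mul
        (continuous_wt hy')).intervalIntegrable _ _
  rw [hs, integral_cos_mul_wt hy']
  ring

theorem half_add_int_ne_neg_nat (n : ℤ) (k : ℕ) : (1 / 2 + n : ℂ) ≠ -k := by
  intro h
  apply half_add_int_ne_zero (n + k)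
  push_cast
  linear_combination h

theorem digamma_half_add_int_succ (n : ℤ) :
    digamma (1 / 2 + ((n + 1 : ℤ) : ℂ)) = digamma (1 / 2 + n) + (1 / 2 + (n : ℂ))⁻¹ := by
  rw [← digamma_apply_add_one _ (half_add_int_ne_neg_nat n)]
  push_cast; ring_nf

/-- The digamma combination in the `k`-th term of the expansion of the diagonal values. -/
def psiCoeff (m : ℤ) (k : ℕ) : ℂ :=
  2 * digamma (1 + k) - digamma (1 / 2 + m + k) - digamma (1 / 2 - m + k)

/-- Both digamma values increase by 1/(m+1/2). This is half the increment of the integrals' limits,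
so the asymptotics for all m follow from m = 0. -/
theorem psiCoeff_zero_succ (m : ℤ) :
    psiCoeff (m + 1) 0 = psiCoeff m 0 - 2 / (m + 1 / 2) := by
  have h1 := digamma_half_add_int_succ m
  have h2 := digamma_half_add_int_succ (-(m + 1))
  have hm := half_add_int_ne_zero m
  have e : (1 / 2 + ((-(m + 1) : ℤ) : ℂ))⁻¹ = -(1 / 2 + (m : ℂ))⁻¹ := by
    rw [← inv_neg]; push_cast; ring_nf
  rw [e, show -(m + 1) + 1 = -m by ring] at h2
  simp only [psiCoeff, Nat.cast_zero, add_zero]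
  push_cast at *
  rw [← sub_eq_add_neg] at h2
  rw [h1, show (1 / 2 : ℂ) - (m + 1) = 1 / 2 + (-1 + -m) by ring] at *
  rw [show (-(m + 1) : ℂ) = -1 + -m by ring] at h2
  rw [h2, show (m : ℂ) + 1 / 2 = 1 / 2 + m by ring]
  field_simp
  ring

theorem tendsto_diagInt_add_log (m : ℤ) :
    Tendsto (fun y : ℝ => diagInt m (-(1 / 2)) y + 2 * log y) (𝓝[>] 0) (𝓝 (2 * psiCoeff m 0)) := by
  have hdiff : ∀ n : ℤ, Tendsto (fun y : ℝ => diagInt (n + 1) (-(1 / 2)) y -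
      diagInt n (-(1 / 2)) y) (𝓝[>] 0) (𝓝 (2 * psiCoeff (n + 1) 0 - 2 * psiCoeff n 0)) := by
    intro n
    have h := (continuous_ofReal.tendsto _).comp (tendsto_realDiag_succ_sub n)
    have e : ((-4 / (n + 1 / 2) : ℝ) : ℂ) = 2 * psiCoeff (n + 1) 0 - 2 * psiCoeff n 0 := by
      rw [psiCoeff_zero_succ]; push_cast; ring
    rw [e] at h
    refine h.congr' ?_
    filter_upwards [self_mem_nhdsWithin] with y hy
    rw [diagInt_eq_realDiag hy, diagInt_eq_realDiag hy]
    simp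
  induction m using Int.induction_on with
  | zero =>
    have h := (continuous_ofReal.tendsto _).comp tendsto_realDiag_zero_add_log
    have e : ((8 * Real.log 2 : ℝ) : ℂ) = 2 * psiCoeff 0 0 := by
      simp only [psiCoeff, Int.cast_zero, Nat.cast_zero, add_zero, sub_zero]
      rw [digamma_one, digamma_one_half]
      have h2 : ((Real.log 2 : ℝ) : ℂ) = log 2 := by rw [ofReal_log (by norm_num)]; norm_num
      push_cast
      rw [h2]
      ring
    rw [e] at h
    refine h.congr' ?_
    filter_upwards [self_mem_nhdsWithin] with y hy
    have hy' : 0 < y := hy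
    rw [diagInt_eq_realDiag hy]
    simp [ofReal_log hy'.le]
  | succ n ih =>
    have := ih.add (hdiff n)
    convert this using 1
    · ext y; ring
    · congr 1; ring
  | pred n ih =>
    have := ih.sub (hdiff (-n - 1))
    rw [sub_add_cancel] at this
    convert this using 1
    · ext y; ring
    · congr 1; ring

end SquareLattice

end

/-! ### Frobenius solutions and the connection formula -/

noncomputable section

namespace SquareLattice

open Complex Filter Topology

/-- A sequence of at most polynomial growth. -/
def PolyBounded (c : ℕ → ℂ) : Prop := ∃ (C : ℝ) (n : ℕ), ∀ k, ‖c k‖ ≤ C * ((k : ℝ) + 1) ^ n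

theorem PolyBounded.mul {c d : ℕ → ℂ} (hc : PolyBounded c) (hd : PolyBounded d) :
    PolyBounded fun k => c k * d k := by
  obtain ⟨C, n, hC⟩ := hc
  obtain ⟨D, p, hD⟩ := hd
  refine ⟨C * D, n + p, fun k => ?_⟩
  rw [norm_mul, pow_add]
  calc ‖c k‖ * ‖d k‖ ≤ (C * ((k : ℝ) + 1) ^ n) * (D * ((k : ℝ) + 1) ^ p) :=
        mul_le_mul (hC k) (hD k) (norm_nonneg _) ((norm_nonneg _).trans (hC k))
    _ = _ := by ring

theorem PolyBounded.add {c d : ℕ → ℂ} (hc : PolyBounded c) (hd : PolyBounded d) :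
    PolyBounded fun k => c k + d k := by
  obtain ⟨C, n, hC⟩ := hc
  obtain ⟨D, p, hD⟩ := hd
  refine ⟨|C| + |D|, n + p, fun k => (norm_add_le _ _).trans ?_⟩
  have h1 : (1 : ℝ) ≤ (k : ℝ) + 1 := by simp
  have e1 : C * ((k : ℝ) + 1) ^ n ≤ |C| * ((k : ℝ) + 1) ^ (n + p) :=
    mul_le_mul (le_abs_self C) (pow_le_pow_right₀ h1 (by omega)) (by positivity) (abs_nonneg _)
  have e2 : D * ((k : ℝ) + 1) ^ p ≤ |D| * ((k : ℝ) + 1) ^ (n + p) :=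
    mul_le_mul (le_abs_self D) (pow_le_pow_right₀ h1 (by omega)) (by positivity) (abs_nonneg _)
  rw [add_mul]
  exact add_le_add ((hC k).trans e1) ((hD k).trans e2)

theorem polyBounded_const (a : ℂ) : PolyBounded fun _ => a := ⟨‖a‖, 0, fun k => by simp⟩

theorem polyBounded_natCast : PolyBounded fun k => (k : ℂ) :=
  ⟨1, 1, fun k => by simp⟩

theorem PolyBounded.shift {c : ℕ → ℂ} (hc : PolyBounded c) : PolyBounded fun k => c (k + 1) := by
  obtain ⟨C, n, hC⟩ := hc
  refine ⟨|C| * 2 ^ n, n, fun k => (hC (k + 1)).trans ?_⟩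
  rw [mul_assoc, ← mul_pow]
  refine mul_le_mul (le_abs_self C) (pow_le_pow_left₀ (by positivity) ?_ n) (by positivity)
    (abs_nonneg _)
  push_cast
  linarith [(Nat.cast_nonneg k : (0 : ℝ) ≤ k)]

theorem PolyBounded.summable_norm {c : ℕ → ℂ} (hc : PolyBounded c) {r : ℝ} (h0 : 0 ≤ r)
    (h1 : r < 1) : Summable fun k => ‖c k‖ * r ^ k := by
  obtain ⟨C, n, hC⟩ := hc
  obtain ⟨s, hrs, hs1⟩ := exists_between h1
  have hs0 : 0 < s := h0.trans_lt hrs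
  have hs : ‖s‖ < 1 := by rwa [Real.norm_of_nonneg hs0.le]
  have h2 : Summable fun k : ℕ => ((k + 1 : ℕ) : ℝ) ^ n * s ^ (k + 1) :=
    (summable_nat_add_iff (f := fun k : ℕ => (k : ℝ) ^ n * s ^ k) 1).2
      (summable_pow_mul_geometric_of_norm_lt_one n hs)
  have h3 := h2.mul_left (C * s⁻¹)
  have e : ∀ k : ℕ, C * s⁻¹ * (((k + 1 : ℕ) : ℝ) ^ n * s ^ (k + 1)) =
      C * ((k : ℝ) + 1) ^ n * s ^ k := by
    intro k
    rw [pow_succ s, Nat.cast_add, Nat.cast_one]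
    field_simp
  simp only [e] at h3
  refine Summable.of_nonneg_of_le (fun k => by positivity) (fun k => ?_) h3
  exact mul_le_mul (hC k) (pow_le_pow_left₀ h0 hrs.le k) (pow_nonneg h0 k)
    ((norm_nonneg _).trans (hC k))

/-- The sum of a power series with given coefficients. -/
def powSum (c : ℕ → ℂ) (y : ℂ) : ℂ := ∑' k, c k * y ^ k

theorem PolyBounded.summable {c : ℕ → ℂ} (hc : PolyBounded c) {y : ℂ} (hy : ‖y‖ < 1) :
    Summable fun k => c k * y ^ k := by
  apply Summable.of_norm
  simpa [norm_mul, norm_pow] using hc.summable_norm (norm_nonneg y) hy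

/-- The coefficients of the derivative of a power series. -/
def derivCoeff (c : ℕ → ℂ) (k : ℕ) : ℂ := ((k : ℂ) + 1) * c (k + 1)

theorem PolyBounded.derivCoeff {c : ℕ → ℂ} (hc : PolyBounded c) : PolyBounded (derivCoeff c) :=
  (polyBounded_natCast.add (polyBounded_const 1)).mul hc.shift

theorem powSum_add {c d : ℕ → ℂ} (hc : PolyBounded c) (hd : PolyBounded d) {y : ℂ} (hy : ‖y‖ < 1) :
    powSum (fun k => c k + d k) y = powSum c y + powSum d y := by
  simp only [powSum, add_mul]
  exact (hc.summable hy).tsum_add (hd.summable hy)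

theorem powSum_const_mul (a : ℂ) (c : ℕ → ℂ) (y : ℂ) :
    powSum (fun k => a * c k) y = a * powSum c y := by
  simp only [powSum, mul_assoc, tsum_mul_left]

theorem powSum_eq_add {c : ℕ → ℂ} (hc : PolyBounded c) {y : ℂ} (hy : ‖y‖ < 1) :
    powSum c y = c 0 + y * powSum (fun k => c (k + 1)) y := by
  simp only [powSum]
  rw [(hc.summable hy).tsum_eq_zero_add, ← tsum_mul_left]
  congr 1
  · simp
  · exact tsum_congr fun k => by ring

theorem mul_powSum_derivCoeff {c : ℕ → ℂ} (hc : PolyBounded c) {y : ℂ} (hy : ‖y‖ < 1) :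
    y * powSum (derivCoeff c) y = powSum (fun k => (k : ℂ) * c k) y := by
  have e : (fun k : ℕ => ((k + 1 : ℕ) : ℂ) * c (k + 1)) = derivCoeff c := by
    ext k; simp [derivCoeff]
  rw [powSum_eq_add (polyBounded_natCast.mul hc) hy, e]
  simp

theorem hasDerivAt_powSum {c : ℕ → ℂ} (hc : PolyBounded c) {y : ℂ} (hy : ‖y‖ < 1) :
    HasDerivAt (powSum c) (powSum (derivCoeff c) y) y := by
  obtain ⟨ρ, h1, h2⟩ := exists_between hy
  have hρ : 0 < ρ := (norm_nonneg y).trans_lt h1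
  have hu : Summable fun k : ℕ => ‖c k‖ * ((k : ℝ) * ρ ^ (k - 1)) := by
    rw [← summable_nat_add_iff 1]
    refine (hc.derivCoeff.summable_norm hρ.le h2).congr fun k => ?_
    have : ‖(k : ℂ) + 1‖ = (k : ℝ) + 1 := by
      have := Complex.norm_natCast (k + 1)
      push_cast at this
      exact this
    rw [SquareLattice.derivCoeff, norm_mul, this]
    push_cast
    ring
  have h := hasDerivAt_tsum_of_isPreconnected (g := fun k z => c k * z ^ k)
    (g' := fun k z => c k * ((k : ℂ) * z ^ (k - 1))) hu Metric.isOpen_ball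
    (convex_ball (0 : ℂ) ρ).isPreconnected
    (fun k z _ => (hasDerivAt_pow k z).const_mul (c k))
    (fun k z hz => by
      rw [norm_mul, norm_mul, norm_pow, Complex.norm_natCast]
      have : ‖z‖ ≤ ρ := (mem_ball_zero_iff.1 hz).le
      gcongr)
    (y₀ := y) (by simpa using h1) (hc.summable hy) (y := y) (by simpa using h1)
  have e : ∑' k, c k * ((k : ℂ) * y ^ (k - 1)) = powSum (derivCoeff c) y := by
    have hs : Summable fun k : ℕ => c k * ((k : ℂ) * y ^ (k - 1)) := by
      rw [← summable_nat_add_iff 1]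
      refine (hc.derivCoeff.summable hy).congr fun k => ?_
      simp [derivCoeff]; ring
    rw [hs.tsum_eq_zero_add, powSum]
    simp only [Nat.cast_zero, zero_mul, mul_zero, zero_add]
    exact tsum_congr fun k => by simp [derivCoeff]; ring
  rw [e] at h
  exact h

/-- The hypergeometric differential operator applied to a power series. -/
theorem powSum_ode {c : ℕ → ℂ} (hc : PolyBounded c) {y : ℂ} (hy : ‖y‖ < 1) (q : ℂ) :
    y * (1 + y) * powSum (derivCoeff (derivCoeff c)) y + (1 + 2 * y) * powSum (derivCoeff c) y +
      q * powSum c y =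
    powSum (fun k => ((k : ℂ) + 1) ^ 2 * c (k + 1) + ((k : ℂ) * (k + 1) + q) * c k) y := by
  have h1 := mul_powSum_derivCoeff hc hy
  have h2 := mul_powSum_derivCoeff hc.derivCoeff hy
  have hk : PolyBounded fun k => ((k : ℂ) + -1) := polyBounded_natCast.add (polyBounded_const (-1))
  have h3 := mul_powSum_derivCoeff (hk.mul hc) hy
  have e : (fun k : ℕ => (k : ℂ) * derivCoeff c k) = derivCoeff fun k => ((k : ℂ) + -1) * c k := by
    ext k; simp [derivCoeff]; ring
  rw [← e, ← h2] at h3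
  have p1 : PolyBounded fun k => (k : ℂ) * derivCoeff c k := polyBounded_natCast.mul hc.derivCoeff
  have p2 : PolyBounded fun k => (k : ℂ) * (((k : ℂ) + -1) * c k) :=
    polyBounded_natCast.mul (hk.mul hc)
  have p3 : PolyBounded fun k => 2 * ((k : ℂ) * c k) :=
    (polyBounded_const 2).mul (polyBounded_natCast.mul hc)
  have p4 : PolyBounded fun k => q * c k := (polyBounded_const q).mul hc
  have e2 : (fun k : ℕ => ((k : ℂ) + 1) ^ 2 * c (k + 1) + ((k : ℂ) * (k + 1) + q) * c k) =
      fun k : ℕ => (((k : ℂ) * derivCoeff c k + (k : ℂ) * (((k : ℂ) + -1) * c k)) +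
        (derivCoeff c k + 2 * ((k : ℂ) * c k))) + q * c k := by
    ext k; simp only [derivCoeff]; ring
  rw [e2, powSum_add ((p1.add p2).add (hc.derivCoeff.add p3)) p4 hy,
    powSum_add (p1.add p2) (hc.derivCoeff.add p3) hy, powSum_add p1 p2 hy,
    powSum_add hc.derivCoeff p3 hy, powSum_const_mul, powSum_const_mul, ← h1, ← h2, ← h3]
  ring

/-- The coefficients of the regular solution. -/
def regCoeff (m : ℤ) (k : ℕ) : ℂ :=
  (-1) ^ k * (poch (1 / 2 + m) k * poch (1 / 2 - m) k / ((k.factorial : ℂ) * (k.factorial : ℂ)))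

theorem regCoeff_succ (m : ℤ) (k : ℕ) :
    ((k : ℂ) + 1) ^ 2 * regCoeff m (k + 1) =
      -((1 / 2 + m + k) * (1 / 2 - m + k)) * regCoeff m k := by
  have hk : (k + 1 : ℂ) ≠ 0 := by exact_mod_cast k.succ_ne_zero
  have hf := factorial_ne k
  simp only [regCoeff, poch_succ_right, Nat.factorial_succ, pow_succ]
  push_cast
  field_simp

theorem regCoeff_zero (m : ℤ) : regCoeff m 0 = 1 := by simp [regCoeff, poch_zero]

/-- The ratio of consecutive norms is at most 1 + m²/(k+1)², hence at most (1 + 1/(k+1))^{m²} by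
Bernoulli; the product telescopes to (k+1)^{m²}. -/
theorem polyBounded_regCoeff (m : ℤ) : PolyBounded (regCoeff m) := by
  refine ⟨1, m.natAbs ^ 2, fun k => ?_⟩
  rw [one_mul]
  induction k with
  | zero => simp [regCoeff_zero]
  | succ k ih =>
    have h := congrArg norm (regCoeff_succ m k)
    have hk0 : (0 : ℝ) ≤ k := Nat.cast_nonneg k
    have e1 : ‖((k : ℂ) + 1) ^ 2‖ = ((k : ℝ) + 1) ^ 2 := by
      rw [norm_pow]
      congr 1
      have := Complex.norm_natCast (k + 1)
      push_cast at this
      exact this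
    have e2 : ‖-((1 / 2 + (m : ℂ) + k) * (1 / 2 - m + k))‖ ≤ ((k : ℝ) + 1) ^ 2 + (m : ℝ) ^ 2 := by
      have : -((1 / 2 + (m : ℂ) + k) * (1 / 2 - m + k)) =
          ((((m : ℝ) ^ 2 - (k + 1 / 2) ^ 2 : ℝ)) : ℂ) := by push_cast; ring
      rw [this, norm_real, Real.norm_eq_abs, abs_le]
      constructor <;> nlinarith [sq_nonneg (m : ℝ)]
    rw [norm_mul, norm_mul, e1] at h
    have hM : ((m.natAbs ^ 2 : ℕ) : ℝ) = (m : ℝ) ^ 2 := by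
      push_cast
      rw [Nat.cast_natAbs]
      simp
    have hber := one_add_mul_le_pow (a := ((k : ℝ) + 1)⁻¹)
      (by linarith [inv_nonneg.2 (by linarith : (0 : ℝ) ≤ (k : ℝ) + 1)]) (m.natAbs ^ 2)
    rw [hM] at hber
    have hk1 : (0 : ℝ) < (k : ℝ) + 1 := by linarith
    have hle : 1 + (m : ℝ) ^ 2 / ((k : ℝ) + 1) ^ 2 ≤ 1 + (m : ℝ) ^ 2 * ((k : ℝ) + 1)⁻¹ := by
      rw [← div_eq_mul_inv]
      have : (m : ℝ) ^ 2 / ((k : ℝ) + 1) ^ 2 ≤ (m : ℝ) ^ 2 / ((k : ℝ) + 1) := by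
        apply div_le_div_of_nonneg_left (sq_nonneg _) hk1
        nlinarith
      linarith
    have hnorm : ‖regCoeff m (k + 1)‖ ≤ (1 + (m : ℝ) ^ 2 / ((k : ℝ) + 1) ^ 2) * ‖regCoeff m k‖ := by
      have h4 : ((k : ℝ) + 1) ^ 2 * ‖regCoeff m (k + 1)‖ ≤
          (((k : ℝ) + 1) ^ 2 + (m : ℝ) ^ 2) * ‖regCoeff m k‖ := by
        rw [h]; exact mul_le_mul_of_nonneg_right e2 (norm_nonneg _)
      rw [← mul_le_mul_iff_right₀ (pow_pos hk1 2)]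
      refine h4.trans (le_of_eq ?_)
      field_simp
    calc ‖regCoeff m (k + 1)‖ ≤ (1 + ((k : ℝ) + 1)⁻¹) ^ (m.natAbs ^ 2) *
          ((k : ℝ) + 1) ^ (m.natAbs ^ 2) :=
          hnorm.trans (mul_le_mul (hle.trans hber) ih (norm_nonneg _) (by positivity))
      _ = _ := by
          rw [← mul_pow]
          congr 1
          push_cast
          field_simp

theorem psiCoeff_succ (m : ℤ) (k : ℕ) :
    psiCoeff m (k + 1) = psiCoeff m k +
      (2 / ((k : ℂ) + 1) - 1 / (1 / 2 + m + k) - 1 / (1 / 2 - m + k)) := by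
  have h1 := digamma_half_add_int_succ (m + k)
  have h2 := digamma_half_add_int_succ (-m + k)
  have h3 := digamma_apply_add_one ((k : ℂ) + 1) (fun n h => by
    have : ((k + 1 + n : ℕ) : ℂ) = 0 := by push_cast; rw [h]; ring
    have : k + 1 + n = 0 := by exact_mod_cast this
    omega)
  push_cast at h1 h2
  simp only [psiCoeff]
  push_cast
  rw [show (1 : ℂ) + (k + 1) = k + 1 + 1 by ring, h3,
    show (1 / 2 : ℂ) + m + (k + 1) = 1 / 2 + (m + k + 1) by ring, h1,
    show (1 / 2 : ℂ) - m + (k + 1) = 1 / 2 + (-m + k + 1) by ring, h2, add_comm (1 : ℂ) k,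
    show (1 / 2 : ℂ) + m + k = 1 / 2 + (m + k) by ring,
    show (1 / 2 : ℂ) - m + k = 1 / 2 + (-m + k) by ring]
  ring

theorem norm_inv_half_add_int_le (n : ℤ) : ‖(1 : ℂ) / (1 / 2 + n)‖ ≤ 2 := by
  have h : (1 : ℝ) ≤ |((1 + 2 * n : ℤ) : ℝ)| := by
    rw [← Int.cast_abs]
    exact_mod_cast Int.one_le_abs (by omega)
  have e : (1 : ℂ) / (1 / 2 + n) = ((2 / ((1 + 2 * n : ℤ) : ℝ) : ℝ) : ℂ) := by
    have h1 := half_add_int_ne_zero n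
    have h2 : (1 + 2 * n : ℂ) ≠ 0 := by
      intro h; apply h1; linear_combination h / 2
    push_cast
    field_simp
  rw [e, norm_real, norm_div, Real.norm_eq_abs, Real.norm_eq_abs, abs_two]
  exact div_le_self (by norm_num) h

theorem polyBounded_psiCoeff (m : ℤ) : PolyBounded (psiCoeff m) := by
  refine ⟨‖psiCoeff m 0‖ + 6, 1, fun k => ?_⟩
  rw [pow_one]
  induction k with
  | zero => simp
  | succ k ih =>
    rw [psiCoeff_succ]
    have h1 := norm_inv_half_add_int_le (m + k)
    have h2 := norm_inv_half_add_int_le (-m + k)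
    push_cast at h1 h2
    rw [← add_assoc] at h1 h2
    rw [← sub_eq_add_neg] at h2
    have h3 : ‖(2 : ℂ) / ((k : ℂ) + 1)‖ ≤ 2 := by
      have := Complex.norm_natCast (k + 1)
      push_cast at this
      rw [norm_div, this, Complex.norm_two]
      exact div_le_self (by norm_num) (by simp)
    have h4 := norm_sub_le (2 / ((k : ℂ) + 1) - 1 / (1 / 2 + m + k)) (1 / (1 / 2 - (m : ℂ) + k))
    have h5 := norm_sub_le (2 / ((k : ℂ) + 1)) (1 / (1 / 2 + (m : ℂ) + k))
    refine (norm_add_le _ _).trans ?_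
    push_cast
    nlinarith [norm_nonneg (psiCoeff m 0)]

/-- The regular solution at `0`. -/
def regSol (m : ℤ) : ℂ → ℂ := powSum (regCoeff m)

/-- The regular part of the logarithmic solution at `0`. -/
def logPart (m : ℤ) : ℂ → ℂ := powSum fun k => regCoeff m k * psiCoeff m k

theorem polyBounded_logPart (m : ℤ) : PolyBounded fun k => regCoeff m k * psiCoeff m k :=
  (polyBounded_regCoeff m).mul (polyBounded_psiCoeff m)

theorem regSol_ode (m : ℤ) {y : ℂ} (hy : ‖y‖ < 1) :
    y * (1 + y) * powSum (derivCoeff (derivCoeff (regCoeff m))) y +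
      (1 + 2 * y) * powSum (derivCoeff (regCoeff m)) y + (1 / 4 - m ^ 2) * regSol m y = 0 := by
  rw [regSol, powSum_ode (polyBounded_regCoeff m) hy]
  have : (fun k : ℕ => ((k : ℂ) + 1) ^ 2 * regCoeff m (k + 1) +
      ((k : ℂ) * (k + 1) + (1 / 4 - (m : ℂ) ^ 2)) * regCoeff m k) = fun _ => 0 := by
    ext k
    rw [regCoeff_succ]; ring
  rw [this]
  simp [powSum]

/-- The right-hand side is what the operator produces from F log y beyond log y times its value on
F, so A - F log y solves the homogeneous equation. The digamma recurrence yields exactly these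
terms. -/
theorem logPart_ode (m : ℤ) {y : ℂ} (hy : ‖y‖ < 1) :
    y * (1 + y) * powSum (derivCoeff (derivCoeff fun k => regCoeff m k * psiCoeff m k)) y +
      (1 + 2 * y) * powSum (derivCoeff fun k => regCoeff m k * psiCoeff m k) y +
        (1 / 4 - m ^ 2) * logPart m y =
      2 * (1 + y) * powSum (derivCoeff (regCoeff m)) y + regSol m y := by
  have hc := polyBounded_regCoeff m
  rw [logPart, powSum_ode (polyBounded_logPart m) hy]
  have : (fun k : ℕ => ((k : ℂ) + 1) ^ 2 * (regCoeff m (k + 1) * psiCoeff m (k + 1)) +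
      ((k : ℂ) * (k + 1) + (1 / 4 - (m : ℂ) ^ 2)) * (regCoeff m k * psiCoeff m k)) = fun k : ℕ =>
        2 * (derivCoeff (regCoeff m) k + (k : ℂ) * regCoeff m k) + regCoeff m k := by
    ext k
    have h := regCoeff_succ m k
    have hk : (k + 1 : ℂ) ≠ 0 := by exact_mod_cast k.succ_ne_zero
    have h1 : (1 / 2 + m + k : ℂ) ≠ 0 := by
      have := half_add_int_ne_zero (m + k); push_cast at this; rwa [← add_assoc] at this
    have h2 : (1 / 2 - m + k : ℂ) ≠ 0 := by
      have := half_add_int_ne_zero (-m + k); push_cast at this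
      rwa [← add_assoc, ← sub_eq_add_neg] at this
    have h3 : ((k : ℂ) + 1) ^ 2 * regCoeff m (k + 1) *
        (2 / ((k : ℂ) + 1) - 1 / (1 / 2 + m + k) - 1 / (1 / 2 - m + k)) =
        2 * (((k : ℂ) + 1) * regCoeff m (k + 1)) + (2 * k + 1) * regCoeff m k := by
      rw [mul_sub, mul_sub]
      have e1 : ((k : ℂ) + 1) ^ 2 * regCoeff m (k + 1) * (2 / ((k : ℂ) + 1)) =
        2 * (((k : ℂ) + 1) * regCoeff m (k + 1)) := by field_simp
      have e2 : ((k : ℂ) + 1) ^ 2 * regCoeff m (k + 1) * (1 / (1 / 2 + m + k)) =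
          -(1 / 2 - m + k) * regCoeff m k := by
        rw [h, mul_one_div, div_eq_iff h1]; ring
      have e3 : ((k : ℂ) + 1) ^ 2 * regCoeff m (k + 1) * (1 / (1 / 2 - m + k)) =
          -(1 / 2 + m + k) * regCoeff m k := by
        rw [h, mul_one_div, div_eq_iff h2]; ring
      rw [e1, e2, e3]; ring
    rw [psiCoeff_succ]
    simp only [derivCoeff]
    linear_combination h3 + psiCoeff m k * h
  rw [this, powSum_add ((polyBounded_const 2).mul (hc.derivCoeff.add (polyBounded_natCast.mul hc)))
    hc hy, powSum_const_mul, powSum_add hc.derivCoeff (polyBounded_natCast.mul hc) hy,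
    ← mul_powSum_derivCoeff hc hy]
  simp only [regSol]
  ring

/-- The unit disc, slit along the negative real axis. -/
def slitDisc : Set ℂ := slitPlane ∩ Metric.ball 0 1

theorem isOpen_slitDisc : IsOpen slitDisc := isOpen_slitPlane.inter Metric.isOpen_ball

/-- Both sets are star-shaped about 1/2. -/
theorem isPreconnected_slitDisc : IsPreconnected slitDisc := by
  have h1 : StarConvex ℝ ((1 / 2 : ℝ) : ℂ) slitPlane := starConvex_ofReal_slitPlane (by norm_num)
  have h2 : StarConvex ℝ ((1 / 2 : ℝ) : ℂ) (Metric.ball (0 : ℂ) 1) :=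
    (convex_ball (0 : ℂ) 1).starConvex (by
      rw [mem_ball_zero_iff, norm_real]; norm_num)
  have hmem : ((1 / 2 : ℝ) : ℂ) ∈ slitPlane ∩ Metric.ball (0 : ℂ) 1 := by
    refine ⟨by rw [ofReal_mem_slitPlane]; norm_num, ?_⟩
    rw [mem_ball_zero_iff, norm_real]
    norm_num
  exact ((h1.inter h2).isPathConnected hmem).isConnected.isPreconnected

/-- Abel's identity for the hypergeometric equation on the slit disc. -/
theorem wronskian_const {f f1 f2 g g1 g2 : ℂ → ℂ} {q : ℂ}
    (hf : ∀ y ∈ slitDisc, HasDerivAt f (f1 y) y) (hf1 : ∀ y ∈ slitDisc, HasDerivAt f1 (f2 y) y)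
    (hg : ∀ y ∈ slitDisc, HasDerivAt g (g1 y) y) (hg1 : ∀ y ∈ slitDisc, HasDerivAt g1 (g2 y) y)
    (of : ∀ y ∈ slitDisc, y * (1 + y) * f2 y + (1 + 2 * y) * f1 y + q * f y = 0)
    (og : ∀ y ∈ slitDisc, y * (1 + y) * g2 y + (1 + 2 * y) * g1 y + q * g y = 0) :
    ∃ C, ∀ y ∈ slitDisc, y * (1 + y) * (f y * g1 y - f1 y * g y) = C := by
  have hd : ∀ y ∈ slitDisc, HasDerivAt
      (fun y => y * (1 + y) * (f y * g1 y - f1 y * g y)) 0 y := by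
    intro y hy
    have hp : HasDerivAt (fun y : ℂ => y * (1 + y)) (1 * (1 + y) + y * 1) y :=
      (hasDerivAt_id y).mul ((hasDerivAt_id y).const_add 1)
    have hw := ((hf y hy).mul (hg1 y hy)).sub ((hf1 y hy).mul (hg y hy))
    refine (hp.mul hw).congr_deriv ?_
    simp only [Pi.sub_apply, Pi.mul_apply]
    linear_combination f y * og y hy - g y * of y hy
  exact isOpen_slitDisc.exists_is_const_of_deriv_eq_zero isPreconnected_slitDisc
    (fun y hy => (hd y hy).differentiableAt.differentiableWithinAt) fun y hy => (hd y hy).deriv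

theorem tendsto_powSum_zero {c : ℕ → ℂ} (hc : PolyBounded c) :
    Tendsto (fun y : ℝ => powSum c y) (𝓝[>] 0) (𝓝 (c 0)) := by
  have h := (hasDerivAt_powSum hc (y := 0) (by simp)).continuousAt.tendsto
  have h0 : powSum c 0 = c 0 := by
    rw [powSum_eq_add hc (by simp), zero_mul, add_zero]
  rw [h0] at h
  have h1 : Tendsto (fun y : ℝ => (y : ℂ)) (𝓝[>] 0) (𝓝 0) := by
    have := (continuous_ofReal.tendsto 0).mono_left (nhdsWithin_le_nhds (s := Set.Ioi (0 : ℝ)))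
    simpa using this
  exact h.comp h1

theorem eventually_mem_slitDisc : ∀ᶠ y : ℝ in 𝓝[>] 0, (y : ℂ) ∈ slitDisc := by
  filter_upwards [Ioo_mem_nhdsGT (zero_lt_one' ℝ)] with y hy
  refine ⟨by simpa using hy.1, ?_⟩
  rw [mem_ball_zero_iff, norm_real, Real.norm_of_nonneg hy.1.le]
  exact hy.2

theorem tendsto_ofReal_mul_log :
    Tendsto (fun y : ℝ => (y : ℂ) * log y) (𝓝[>] 0) (𝓝 0) := by
  have h := tendsto_log_mul_rpow_nhdsGT_zero zero_lt_one
  have h2 := (continuous_ofReal.tendsto _).comp h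
  rw [ofReal_zero] at h2
  refine h2.congr' ?_
  filter_upwards [self_mem_nhdsWithin] with y hy
  simp [ofReal_log (le_of_lt hy), mul_comm]

theorem eq_zero_of_tendsto_mul_log {a b : ℂ}
    (h : Tendsto (fun y : ℝ => a * log y) (𝓝[>] 0) (𝓝 b)) : a = 0 := by
  have h1 : Tendsto (fun y : ℝ => (Real.log y)⁻¹) (𝓝[>] 0) (𝓝 0) :=
    Real.tendsto_log_nhdsGT_zero.inv_tendsto_atBot
  have h2 := (continuous_ofReal.tendsto _).comp h1
  rw [ofReal_zero] at h2
  have h3 := h.mul h2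
  rw [mul_zero] at h3
  refine tendsto_nhds_unique (tendsto_const_nhds.congr' ?_) h3
  filter_upwards [Ioo_mem_nhdsGT (zero_lt_one' ℝ)] with y hy
  have hl : Real.log y ≠ 0 := (Real.log_neg hy.1 hy.2).ne
  have : (Real.log y : ℂ) ≠ 0 := by exact_mod_cast hl
  simp only [Function.comp]
  rw [← ofReal_log hy.1.le, ofReal_inv, mul_inv_cancel_right₀ this]

/-- The connection formula: the diagonal integral is twice the logarithmic solution at `0`. -/
theorem diagInt_eq (m : ℤ) {y : ℂ} (hy : y ∈ slitDisc) :
    diagInt m (-(1 / 2)) y = 2 * (logPart m y - regSol m y * log y) := by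
  have hnorm : ∀ y ∈ slitDisc, ‖y‖ < 1 := fun y hy => mem_ball_zero_iff.1 hy.2
  have hc := polyBounded_regCoeff m
  have hl := polyBounded_logPart m
  set F := regSol m with hF
  set F1 := powSum (derivCoeff (regCoeff m)) with hF1
  set F2 := powSum (derivCoeff (derivCoeff (regCoeff m))) with hF2
  set A := logPart m with hA
  set A1 := powSum (derivCoeff fun k => regCoeff m k * psiCoeff m k) with hA1
  set A2 := powSum (derivCoeff (derivCoeff fun k => regCoeff m k * psiCoeff m k)) with hA2
  set J := diagInt m (-(1 / 2)) with hJ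
  have dF : ∀ y ∈ slitDisc, HasDerivAt F (F1 y) y := fun y hy => hasDerivAt_powSum hc (hnorm y hy)
  have dF1 : ∀ y ∈ slitDisc, HasDerivAt F1 (F2 y) y := fun y hy =>
    hasDerivAt_powSum hc.derivCoeff (hnorm y hy)
  have dA : ∀ y ∈ slitDisc, HasDerivAt A (A1 y) y := fun y hy => hasDerivAt_powSum hl (hnorm y hy)
  have dA1 : ∀ y ∈ slitDisc, HasDerivAt A1 (A2 y) y := fun y hy =>
    hasDerivAt_powSum hl.derivCoeff (hnorm y hy)
  have oF : ∀ y ∈ slitDisc, y * (1 + y) * F2 y + (1 + 2 * y) * F1 y + (1 / 4 - m ^ 2) * F y = 0 :=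
    fun y hy => regSol_ode m (hnorm y hy)
  have dJ : ∀ y ∈ slitDisc, HasDerivAt J (-(1 / 2) * diagInt m (-(3 / 2)) y) y := by
    intro y hy
    have := hasDerivAt_diagInt hy.1 m (-(1 / 2))
    rw [show (-(1 / 2) - 1 : ℂ) = -(3 / 2) by norm_num] at this
    exact this
  have dJ1 : ∀ y ∈ slitDisc, HasDerivAt (fun y => -(1 / 2) * diagInt m (-(3 / 2)) y)
      (3 / 4 * diagInt m (-(5 / 2)) y) y := by
    intro y hy
    have := (hasDerivAt_diagInt hy.1 m (-(3 / 2))).const_mul (-(1 / 2))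
    rw [show (-(3 / 2) - 1 : ℂ) = -(5 / 2) by norm_num] at this
    exact this.congr_deriv (by ring)
  have oJ : ∀ y ∈ slitDisc, y * (1 + y) * (3 / 4 * diagInt m (-(5 / 2)) y) +
      (1 + 2 * y) * (-(1 / 2) * diagInt m (-(3 / 2)) y) + (1 / 4 - m ^ 2) * J y = 0 := by
    intro y hy
    linear_combination diagInt_ode hy.1 m
  have dL : ∀ y ∈ slitDisc, HasDerivAt (fun y => A y - F y * log y)
      (A1 y - F1 y * log y - F y / y) y := by
    intro y hy
    exact ((dA y hy).sub ((dF y hy).mul (hasDerivAt_log hy.1))).congr_deriv (by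
      rw [div_eq_mul_inv]; ring)
  have dL1 : ∀ y ∈ slitDisc, HasDerivAt (fun y => A1 y - F1 y * log y - F y / y)
      (A2 y - F2 y * log y - 2 * F1 y / y + F y / y ^ 2) y := by
    intro y hy
    have h0 := slitPlane_ne_zero hy.1
    refine (((dA1 y hy).sub ((dF1 y hy).mul (hasDerivAt_log hy.1))).sub
      ((dF y hy).div (hasDerivAt_id y) h0)).congr_deriv ?_
    simp only [id]
    field_simp
    ring
  have oL : ∀ y ∈ slitDisc, y * (1 + y) * (A2 y - F2 y * log y - 2 * F1 y / y + F y / y ^ 2) +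
      (1 + 2 * y) * (A1 y - F1 y * log y - F y / y) +
        (1 / 4 - m ^ 2) * (A y - F y * log y) = 0 := by
    intro y hy
    have h0 := slitPlane_ne_zero hy.1
    have h1 : y * (1 + y) * A2 y + (1 + 2 * y) * A1 y + (1 / 4 - m ^ 2) * A y =
      2 * (1 + y) * F1 y + F y := logPart_ode m (hnorm y hy)
    have h2 : y * (1 + y) * (-(2 * F1 y / y) + F y / y ^ 2) + (1 + 2 * y) * (-(F y / y)) =
        -(2 * (1 + y) * F1 y + F y) := by
      field_simp
      ring
    linear_combination h1 + h2 - log y * oF y hy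
  obtain ⟨C1, h1⟩ := wronskian_const dJ dJ1 dF dF1 oJ oF
  obtain ⟨C2, h2⟩ := wronskian_const dJ dJ1 dL dL1 oJ oL
  obtain ⟨C3, h3⟩ := wronskian_const dF dF1 dL dL1 oF oL
  have tF : Tendsto (fun y : ℝ => F y) (𝓝[>] 0) (𝓝 1) := by
    have := tendsto_powSum_zero hc
    rwa [regCoeff_zero] at this
  have tA : Tendsto (fun y : ℝ => A y) (𝓝[>] 0) (𝓝 (psiCoeff m 0)) := by
    have := tendsto_powSum_zero hl
    rwa [regCoeff_zero, one_mul] at this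
  have ty : Tendsto (fun y : ℝ => (y : ℂ)) (𝓝[>] 0) (𝓝 0) := by
    have := (continuous_ofReal.tendsto 0).mono_left (nhdsWithin_le_nhds (s := Set.Ioi (0 : ℝ)))
    simpa using this
  -- The logarithms cancel in this Wronskian; as y ↓ 0 only -F(0)² = -1 survives.
  have hC3 : C3 = -1 := by
    have t := (ty.const_add 1).mul ((ty.mul ((tF.mul (tendsto_powSum_zero hl.derivCoeff)).sub
      ((tendsto_powSum_zero hc.derivCoeff).mul tA))).sub (tF.mul tF))
    simp only [zero_mul, add_zero, one_mul, zero_sub] at t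
    refine tendsto_nhds_unique (tendsto_const_nhds.congr' ?_) t
    filter_upwards [eventually_mem_slitDisc] with y hy
    have h0 := slitPlane_ne_zero hy.1
    rw [← h3 y hy]
    simp only [← hF1, ← hA1]
    field_simp
    ring
  -- The identity L W(J,F) - F W(J,L) + J W(F,L) = 0, valid for any three functions, expresses J
  -- through L and F with constant coefficients.
  have hJL : ∀ y ∈ slitDisc, J y = C1 * (A y - F y * log y) - C2 * F y := by
    intro y hy
    have e1 := h1 y hy
    have e2 := h2 y hy
    have e3 := h3 y hy
    rw [hC3] at e3
    linear_combination (-(F y)) * e2 + (A y - F y * log y) * e1 - (-J y) * e3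
  have tlim := tendsto_diagInt_add_log m
  have tlog : Tendsto (fun y : ℝ => (F y - 1) * log y) (𝓝[>] 0) (𝓝 0) := by
    have t := tendsto_ofReal_mul_log.mul (tendsto_powSum_zero hc.shift)
    rw [zero_mul] at t
    refine t.congr' ?_
    filter_upwards [eventually_mem_slitDisc] with y hy
    have := powSum_eq_add hc (hnorm y hy)
    rw [regCoeff_zero] at this
    simp only [hF, regSol, this]
    ring
  -- Comparing both expansions of J, a multiple of log y has a finite limit. Hence C1 = 2, and then
  -- that limit must be 0, which gives C2 = 0.
  have t2 : Tendsto (fun y : ℝ => (2 - C1) * log y) (𝓝[>] 0)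
      (𝓝 (2 * psiCoeff m 0 + C1 * 0 - (C1 * psiCoeff m 0 - C2 * 1))) := by
    refine ((tlim.add (tlog.const_mul C1)).sub ((tA.const_mul C1).sub
      (tF.const_mul C2))).congr' ?_
    filter_upwards [eventually_mem_slitDisc] with y hy
    rw [← hJ, hJL y hy]
    ring
  have hC1 : C1 = 2 := by linear_combination -(eq_zero_of_tendsto_mul_log t2)
  have hC2 : C2 = 0 := by
    rw [hC1, sub_self] at t2
    simp only [zero_mul] at t2
    have := tendsto_nhds_unique t2 tendsto_const_nhds
    linear_combination this
  rw [hJL y hy, hC1, hC2]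
  ring

theorem hasSum_P₀ {z : ℂ} (hz : z ∉ ((↑) : ℝ → ℂ) '' Set.Icc (0 : ℝ) 8)
    (hlt : ‖z * (8 - z)‖ < 16) (m : ℤ) {ε : ℂ} (hε : ε = 1 ∨ ε = -1)
    (hre : 0 < (ε * (4 - z)).re) :
    HasSum (fun k : ℕ => ε * ((-1 : ℂ) ^ m / (4 * (Real.pi : ℂ))) * diagTerm z m k) (P₀ z m) := by
  have hpi : (Real.pi : ℂ) ≠ 0 := by exact_mod_cast Real.pi_ne_zero
  have hre' : (4 - z).re ≠ 0 := by
    intro h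
    rcases hε with rfl | rfl <;> simp [sub_re] at hre h <;> linarith
  have hs := mem_slitPlane_of_re_ne hz hre'
  have hn : ‖z * (z - 8) / 16‖ < 1 := by
    rw [norm_div, div_lt_one (by norm_num), ← norm_neg]
    rw [show -(z * (z - 8)) = z * (8 - z) by ring]
    simpa using hlt
  have hy : z * (z - 8) / 16 ∈ slitDisc := ⟨hs, by simpa using hn⟩
  have h1 := ((polyBounded_logPart m).summable hn).hasSum
  have h2 := ((polyBounded_regCoeff m).summable hn).hasSum
  have h := (h1.sub (h2.mul_right (log (z * (z - 8) / 16)))).mul_left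
    (ε * ((-1 : ℂ) ^ m / (4 * (Real.pi : ℂ))))
  have hP : P₀ z m = ε * ((-1 : ℂ) ^ m / (4 * (Real.pi : ℂ))) *
      (logPart m (z * (z - 8) / 16) - regSol m (z * (z - 8) / 16) * log (z * (z - 8) / 16)) := by
    have hG := G_diag hz hε hre hs m
    rw [diagInt_eq m hy] at hG
    simp only [P₀, P, add_zero, sub_zero]
    rw [hG]
    field_simp
    ring
  rw [hP]
  refine h.congr_fun ?_
  intro k
  simp only [diagTerm, regCoeff, psiCoeff]
  -- The factor (-1)^k in `regCoeff` converts powers of y = z(z-8)/16 into powers of z(8-z)/16.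
  rw [show z * (8 - z) / 16 = -1 * (z * (z - 8) / 16) by ring, mul_pow]
  ring

end SquareLattice

end

theorem theorem19080717 :
    (∀ z : ℂ, z ∉ ((↑) : ℝ → ℂ) '' Set.Icc (0 : ℝ) 8 → ‖z * (8 - z)‖ < 16 → ∀ m : ℤ,
      (0 < (4 - z).re →
        HasSum (fun k : ℕ => (-1 : ℂ) ^ m / (4 * (Real.pi : ℂ)) * SquareLattice.diagTerm z m k)
          (SquareLattice.P₀ z m)) ∧
      ((4 - z).re < 0 →
        HasSum (fun k : ℕ => -((-1 : ℂ) ^ m / (4 * (Real.pi : ℂ))) * SquareLattice.diagTerm z m k)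
          (SquareLattice.P₀ z m))) ∧
    (∀ z : ℂ, z ∉ ((↑) : ℝ → ℂ) '' Set.Icc (0 : ℝ) 8 → ∀ m l : ℕ,
      SquareLattice.P z m l =
          (z - 4) / 4 * (m * l) *
            SquareLattice.pFq [1 + m, 1 - m, 1 + l, 1 - l] [1, 3 / 2, 3 / 2] ((z - 4) ^ 2 / 16)
        + SquareLattice.P₀ z 0 *
            SquareLattice.pFq [m, -m, l, -l] [1, 1 / 2, 1 / 2] ((z - 4) ^ 2 / 16)
        + ∑ μ ∈ Finset.Icc 1 m, (SquareLattice.P₀ z μ - SquareLattice.P₀ z ((μ : ℤ) - 1)) *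
            SquareLattice.pFq [1 + m - μ, μ - m, l, -l] [1, 1 / 2, 1 / 2] ((z - 4) ^ 2 / 16)
        + ∑ ν ∈ Finset.Icc 1 l, (SquareLattice.P₀ z ν - SquareLattice.P₀ z ((ν : ℤ) - 1)) *
            SquareLattice.pFq [m, -m, 1 + l - ν, ν - l] [1, 1 / 2, 1 / 2] ((z - 4) ^ 2 / 16)) ∧
    (∀ z : ℂ, z ∉ ((↑) : ℝ → ℂ) '' Set.Icc (0 : ℝ) 8 → ∀ m l : ℕ,
      SquareLattice.Q z m l =
          -(1 / 4) *
            SquareLattice.pFq [1 + m, -m, 1 + l, -l] [1, 1 / 2, 1 / 2] ((z - 4) ^ 2 / 16)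
        + (z - 4) / 4 * (2 * m + 1) * (2 * l + 1) * SquareLattice.P₀ z 0 *
            SquareLattice.pFq [1 + m, -m, 1 + l, -l] [1, 3 / 2, 3 / 2] ((z - 4) ^ 2 / 16)
        - (z - 4) / 4 * (2 * l + 1) *
            ∑ μ ∈ Finset.Icc (-(m : ℤ)) m, SquareLattice.P₀ z μ *
              SquareLattice.pFq [1 + m - (|μ| : ℤ), (|μ| : ℤ) - m, 1 + l, -l] [1, 1 / 2, 3 / 2]
                ((z - 4) ^ 2 / 16)
        - (z - 4) / 4 * (2 * m + 1) *
            ∑ ν ∈ Finset.Icc (-(l : ℤ)) l, SquareLattice.P₀ z ν *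
              SquareLattice.pFq [1 + m, -m, 1 + l - (|ν| : ℤ), (|ν| : ℤ) - l] [1, 1 / 2, 3 / 2]
                ((z - 4) ^ 2 / 16)) := by
  refine ⟨fun z hz hlt m => ⟨fun h => ?_, fun h => ?_⟩, fun z hz m l => SquareLattice.P_formula hz m l,
    fun z hz m l => SquareLattice.Q_formula hz m l⟩
  · simpa using SquareLattice.hasSum_P₀ hz hlt m (Or.inl rfl) (by simpa using h)
  · have := SquareLattice.hasSum_P₀ hz hlt m (Or.inr rfl) (by
      rw [neg_one_mul, Complex.neg_re]; linarith)
    simpa only [neg_one_mul] using this
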